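/- Let $n\ge 3$ and let $K$ be a field of characteristic zero. Let $C_r$ ($r\ge -1$) be the $K$-vector space generated by the ordered partitions $(B_1,\dots,B_{r+2})$ of $\{1,\dots,n\}$ into $r+2$ nonempty blocks, modulo the relations $(B_1,\dots,B_{r+2})=(-1)^{r+1}(B_2,\dots,B_{r+2},B_1)$; write $[B_1,\dots,B_{r+2}]$ for the class of a partition. Let $\Delta(E_n)$ (the cyclic coloring complex of the complete graph with a loop at each vertex) be the complex $\cdots\to C_1\to C_0\to C_{-1}\to 0$ with $$\partial_r[B_1,\dots,B_{r+2}]=\sum_{i=1}^{r+1}(-1)^{i+1}[B_1,\dots,B_i\cup B_{i+1},\dots,B_{r+2}]+(-1)^{r+3}[B_1\cup B_{r+2},B_2,\dots,B_{r+1}]\quad(r\ge 0),$$ and let $\Delta(E_n^{(0,1)})$ be the quotient of $\Delta(E_n)$ by the subcomplex spanned by those $[B_1,\dots,B_{r+2}]$ in which the vertices $2$ and $3$ lie in the same block. Let $HC_r(\Delta(E_n^{(0,1)}))$, $r\ge -1$, be its homology ($\ker\partial_r/\operatorname{im}\partial_{r+1}$). Then: 1. $\dim_K HC_r(\Delta(E_n^{(0,1)}))=\binom{n-2}{r}$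 for all $r\ge 0$, and $HC_{-1}(\Delta(E_n^{(0,1)}))=0$. 2. For every $r\ge -1$ and every $A\subseteq\{2,\dots,n\}$ with $|A|=n-r-2$, let $a_1<\dots<a_{r+1}$ be the elements of $\{2,\dots,n\}\setminus A$. The image $z_A$ in $\Delta(E_n^{(0,1)})$ of $$\sum_{\sigma\in S_{r+1}}\operatorname{sgn}(\sigma)\,[A\cup\{1\},\{a_{\sigma(1)}\},\dots,\{a_{\sigma(r+1)}\}]$$ is a cycle. The homology classes of those $z_A$ for which $A$ does not contain both $2$ and $3$ span $HC_r(\Delta(E_n^{(0,1)}))$, and the classes of those $z_A$ with $3\notin A$ form a basis of it. -/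

import Mathlib

noncomputable section

namespace CyclicColoring

/-- A hypergraph on the vertex set `{1, …, n}`; the vertex `i` is the element `i - 1` of `Fin n`. -/
structure Hypergraph (n : ℕ) where
  edges : Set (Finset (Fin n))

/-- `E_n`: the complete graph on `n` vertices together with a loop at each vertex. -/
def completeLooped (n : ℕ) : Hypergraph n where
  edges := {e | e.card = 1 ∨ e.card = 2}

/-- Ordered partitions `(B_1, …, B_m)` of the vertex set into `m` nonempty blocks, at least one of
which contains a hyperedge of `H`.  The partition is recorded by the surjection that sends a vertex
to the (zero-based) index of its block. -/
def OrdPart {n : ℕ} (H : Hypergraph n) (m : ℕ) : Type :=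
  {f : Fin n → Fin m // Function.Surjective f ∧ ∃ e ∈ H.edges, ∃ j, ∀ v ∈ e, f v = j}

/-- Relabel (and possibly unite) the blocks along a surjection of the index sets. -/
def OrdPart.map {n : ℕ} {H : Hypergraph n} {m m' : ℕ} (g : Fin m → Fin m')
    (hg : Function.Surjective g) (f : OrdPart H m) : OrdPart H m' :=
  ⟨g ∘ f.1, hg.comp f.2.1, by
    obtain ⟨e, he, j, hj⟩ := f.2.2
    exact ⟨e, he, g j, fun v hv => congrArg g (hj v hv)⟩⟩

/-- On block indices: `(B_1, …, B_{k+1}) ↦ (B_2, …, B_{k+1}, B_1)`. -/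
def rotIdx (k : ℕ) (x : Fin (k + 1)) : Fin (k + 1) :=
  ⟨if x.val = 0 then k else x.val - 1, by have := x.isLt; split_ifs <;> omega⟩

/-- On (zero-based) block indices `0, …, k + 1`: for `i ≤ k` the blocks `i` and `i + 1` are united;
for `i = k + 1` the last block is united with the first one, and the union comes first. -/
def mergeIdx (k : ℕ) (i x : Fin (k + 2)) : Fin (k + 1) :=
  ⟨if x.val ≤ i.val then (if x.val ≤ k then x.val else 0) else x.val - 1, by
    have := x.isLt
    split_ifs <;> omega⟩

theorem rotIdx_surjective (k : ℕ) : Function.Surjective (rotIdx k) := by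
  intro y
  have hy := y.isLt
  by_cases h : y.val = k
  · exact ⟨⟨0, by omega⟩, Fin.ext (by simp [rotIdx, h])⟩
  · exact ⟨⟨y.val + 1, by omega⟩, Fin.ext (by simp [rotIdx])⟩

theorem mergeIdx_surjective (k : ℕ) (i : Fin (k + 2)) : Function.Surjective (mergeIdx k i) := by
  intro y
  have hy := y.isLt
  by_cases h : y.val ≤ i.val
  · refine ⟨⟨y.val, by omega⟩, Fin.ext ?_⟩
    simp only [mergeIdx]
    split_ifs <;> omega
  · refine ⟨⟨y.val + 1, by omega⟩, Fin.ext ?_⟩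
    simp only [mergeIdx]
    split_ifs <;> omega

/-- `(B_1, …, B_{k+1}) ↦ (B_2, …, B_{k+1}, B_1)`. -/
def rot {n : ℕ} {H : Hypergraph n} {k : ℕ} (f : OrdPart H (k + 1)) : OrdPart H (k + 1) :=
  f.map (rotIdx k) (rotIdx_surjective k)

/-- Unite two cyclically adjacent blocks. -/
def merge {n : ℕ} {H : Hypergraph n} {k : ℕ} (i : Fin (k + 2)) (f : OrdPart H (k + 2)) :
    OrdPart H (k + 1) :=
  f.map (mergeIdx k i) (mergeIdx_surjective k i)

section Complex

variable (K : Type*) [Field K] {n : ℕ} (H : Hypergraph n)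

/-- The relations `(B_1, …, B_{k+1}) = (-1)^k (B_2, …, B_{k+1}, B_1)`. -/
def cyclicRel (k : ℕ) : Submodule K (OrdPart H (k + 1) →₀ K) :=
  Submodule.span K (Set.range fun f : OrdPart H (k + 1) =>
    Finsupp.single f (1 : K) - (-1 : K) ^ k • Finsupp.single (rot f) (1 : K))

/-- The chains of the cyclic coloring complex `Δ(H)` on partitions into `k + 1` blocks, that is,
the chains of degree `r = k - 1` (so `k = 0` is degree `-1`, the lowest degree). -/
def Chain (k : ℕ) : Type _ := (OrdPart H (k + 1) →₀ K) ⧸ cyclicRel K H k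

instance (k : ℕ) : AddCommGroup (Chain K H k) :=
  inferInstanceAs (AddCommGroup ((OrdPart H (k + 1) →₀ K) ⧸ cyclicRel K H k))

instance (k : ℕ) : Module K (Chain K H k) :=
  inferInstanceAs (Module K ((OrdPart H (k + 1) →₀ K) ⧸ cyclicRel K H k))

/-- The quotient map onto the chains. -/
def Chain.mk (k : ℕ) : (OrdPart H (k + 1) →₀ K) →ₗ[K] Chain K H k := (cyclicRel K H k).mkQ

theorem Chain.ker_mk (k : ℕ) : LinearMap.ker (Chain.mk K H k) = cyclicRel K H k :=
  Submodule.ker_mkQ _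

variable {H} in
/-- The class `[B_1, …, B_{k+1}]`. -/
def cls {k : ℕ} (f : OrdPart H (k + 1)) : Chain K H k :=
  Chain.mk K H k (Finsupp.single f 1)

/-- The signed sum of the unions of cyclically adjacent blocks. -/
def preBoundary (k : ℕ) : (OrdPart H (k + 2) →₀ K) →ₗ[K] (OrdPart H (k + 1) →₀ K) :=
  Finsupp.linearCombination K fun f : OrdPart H (k + 2) =>
    ∑ i : Fin (k + 2), (-1 : K) ^ (i : ℕ) • Finsupp.single (merge i f) (1 : K)

variable {H} in
theorem cls_rot {k : ℕ} (f : OrdPart H (k + 1)) : cls K (rot f) = (-1 : K) ^ k • cls K f := by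
  have h : Finsupp.single f (1 : K) - (-1 : K) ^ k • Finsupp.single (rot f) (1 : K)
      ∈ cyclicRel K H k := Submodule.subset_span ⟨f, rfl⟩
  have h' : cls K f = (-1 : K) ^ k • cls K (rot f) := by
    rw [← Chain.ker_mk K H k, LinearMap.mem_ker, map_sub, map_smul] at h
    exact sub_eq_zero.1 h
  rw [h', smul_smul, ← mul_pow]
  simp

variable {H} in
theorem mk_preBoundary_single {k : ℕ} (f : OrdPart H (k + 2)) :
    Chain.mk K H k (preBoundary K H k (Finsupp.single f 1)) =
      ∑ i : Fin (k + 2), (-1 : K) ^ (i : ℕ) • cls K (merge i f) := by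
  simp only [preBoundary, Finsupp.linearCombination_single, one_smul, map_sum, map_smul, cls]

theorem merge_rot_castSucc {n : ℕ} {H : Hypergraph n} {k : ℕ} (i : Fin (k + 1))
    (f : OrdPart H (k + 2)) : merge i.castSucc (rot f) = rot (merge i.succ f) := by
  apply Subtype.ext
  funext v
  change mergeIdx k i.castSucc (rotIdx (k + 1) (f.1 v)) = rotIdx k (mergeIdx k i.succ (f.1 v))
  obtain ⟨x, hx⟩ := f.1 v
  obtain ⟨i, hi⟩ := i
  apply Fin.ext
  simp only [mergeIdx, rotIdx, Fin.castSucc_mk, Fin.succ_mk]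
  split_ifs <;> omega

theorem merge_rot_last {n : ℕ} {H : Hypergraph n} {k : ℕ}
    (f : OrdPart H (k + 2)) : merge (Fin.last (k + 1)) (rot f) = merge 0 f := by
  apply Subtype.ext
  funext v
  change mergeIdx k (Fin.last (k + 1)) (rotIdx (k + 1) (f.1 v)) = mergeIdx k ⟨0, by omega⟩ (f.1 v)
  obtain ⟨x, hx⟩ := f.1 v
  apply Fin.ext
  simp only [mergeIdx, rotIdx, Fin.val_last]
  split_ifs <;> omega

theorem cyclicRel_le (k : ℕ) :
    cyclicRel K H (k + 1) ≤ (cyclicRel K H k).comap (preBoundary K H k) := by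
  rw [cyclicRel, Submodule.span_le]
  rintro _ ⟨f, rfl⟩
  rw [SetLike.mem_coe, Submodule.mem_comap, ← Chain.ker_mk K H k,
    LinearMap.mem_ker, map_sub, map_sub, map_smul, map_smul, mk_preBoundary_single,
    mk_preBoundary_single, Fin.sum_univ_castSucc (n := k + 1)
      (fun i => (-1 : K) ^ (i : ℕ) • cls K (merge i (rot f))),
    Fin.sum_univ_succ (n := k + 1)]
  simp only [merge_rot_castSucc, merge_rot_last, cls_rot, smul_add, Finset.smul_sum, smul_smul,
    Fin.val_castSucc, Fin.val_succ, Fin.val_last, Fin.val_zero, pow_zero, one_smul]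
  have e1 : (-1 : K) ^ (k + 1) * (-1 : K) ^ (k + 1) = 1 := by rw [← mul_pow]; simp
  have e2 : ∀ i : ℕ, (-1 : K) ^ (k + 1) * ((-1 : K) ^ i * (-1 : K) ^ k) = (-1 : K) ^ (i + 1) := by
    intro i
    have : (-1 : K) ^ k * (-1 : K) ^ k = 1 := by rw [← mul_pow]; simp
    linear_combination (-1 : K) ^ (i + 1) * this
  simp only [e1, e2, one_smul]
  abel

/-- The boundary map `∂` of the cyclic coloring complex, from `k + 2` blocks to `k + 1` blocks:
`[B_1, …, B_{k+2}]` goes to `∑_{i=1}^{k+1} (-1)^{i+1} [B_1, …, B_i ∪ B_{i+1}, …, B_{k+2}] +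
(-1)^{k+3} [B_1 ∪ B_{k+2}, B_2, …, B_{k+1}]`. -/
def boundary (k : ℕ) : Chain K H (k + 1) →ₗ[K] Chain K H k :=
  Submodule.mapQ (cyclicRel K H (k + 1)) (cyclicRel K H k) (preBoundary K H k) (cyclicRel_le K H k)

variable {H} in
theorem boundary_cls {k : ℕ} (f : OrdPart H (k + 2)) :
    boundary K H k (cls K f) =
      ∑ i : Fin (k + 2), (-1 : K) ^ (i : ℕ) • cls K (merge i f) :=
  mk_preBoundary_single K f

theorem merge_merge {n : ℕ} {H : Hypergraph n} {k : ℕ} (i : Fin (k + 2)) (j : Fin (k + 3))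
    (hij : i.val < j.val) (f : OrdPart H (k + 3)) :
    merge i (merge j f) =
      merge ⟨j.val - 1, by omega⟩ (merge ⟨i.val, by omega⟩ f) := by
  apply Subtype.ext
  funext v
  change mergeIdx k i (mergeIdx (k + 1) j (f.1 v)) =
    mergeIdx k ⟨j.val - 1, by omega⟩ (mergeIdx (k + 1) ⟨i.val, by omega⟩ (f.1 v))
  obtain ⟨x, hx⟩ := f.1 v
  obtain ⟨i, hi⟩ := i
  obtain ⟨j, hj⟩ := j
  apply Fin.ext
  simp only [mergeIdx] at hij ⊢
  by_cases c1 : x ≤ i <;> by_cases c2 : x ≤ j <;> by_cases c3 : x ≤ k + 1 <;>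
    simp only [c1, c2, c3, if_true, if_false] <;> split_ifs <;> omega

theorem boundary_boundary (k : ℕ) : boundary K H k ∘ₗ boundary K H (k + 1) = 0 := by
  have key : ∀ f : OrdPart H (k + 3), boundary K H k (boundary K H (k + 1) (cls K f)) = 0 := by
    intro f
    simp only [boundary_cls, map_sum, map_smul, Finset.smul_sum, smul_smul]
    rw [← Finset.sum_product', Finset.univ_product_univ]
    refine Finset.sum_involution
      (fun p _ => if h : p.2.val < p.1.val then
          ((⟨p.2.val, by omega⟩ : Fin (k + 3)), (⟨p.1.val - 1, by omega⟩ : Fin (k + 2)))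
        else ((⟨p.2.val + 1, by omega⟩ : Fin (k + 3)), (⟨p.1.val, by omega⟩ : Fin (k + 2))))
      ?_ ?_ (fun _ _ => Finset.mem_univ _) ?_
    · rintro ⟨j, i⟩ -
      by_cases h : i.val < j.val
      · have e : (-1 : K) ^ (j : ℕ) = -(-1 : K) ^ (j.val - 1) := by
          obtain ⟨m, hm⟩ : ∃ m, j.val = m + 1 := ⟨j.val - 1, by omega⟩
          rw [hm, pow_succ]; simp
        simp only [h, dif_pos, merge_merge i j h f]
        rw [← add_smul, e]
        convert zero_smul K _
        ring
      · have h' : j.val < i.val + 1 := by omega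
        simp only [h, dif_neg, not_false_eq_true]
        have hm := merge_merge (k := k) (⟨j.val, by omega⟩ : Fin (k + 2))
          (⟨i.val + 1, by omega⟩ : Fin (k + 3)) h' f
        simp only [Nat.add_sub_cancel, Fin.eta] at hm
        rw [hm, ← add_smul]
        convert zero_smul K _
        ring
    · rintro ⟨j, i⟩ - - heq
      by_cases h : i.val < j.val
      · simp only [h, dif_pos, Prod.mk.injEq, Fin.ext_iff] at heq
        omega
      · simp only [h, dif_neg, not_false_eq_true, Prod.mk.injEq, Fin.ext_iff] at heq
        omega
    · rintro ⟨j, i⟩ -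
      by_cases h : i.val < j.val
      · have h' : ¬ (j.val - 1 < i.val) := by omega
        have h1 : j.val - 1 + 1 = j.val := by omega
        simp only [h, h', h1, dif_pos, dif_neg, not_false_eq_true, Fin.eta]
      · have h' : j.val < i.val + 1 := by omega
        simp only [h, h', dif_pos, dif_neg, not_false_eq_true, Nat.add_sub_cancel, Fin.eta]
  apply Submodule.linearMap_qext (cyclicRel K H (k + 2))
  apply Finsupp.lhom_ext'
  intro f
  ext
  exact key f

variable (u w : Fin n)

/-- The subcomplex spanned by the partitions in which `u` and `w` lie in the same block. -/
def sameBlock (k : ℕ) : Submodule K (Chain K H k) :=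
  Submodule.span K {c | ∃ f : OrdPart H (k + 1), f.1 u = f.1 w ∧ c = cls K f}

theorem sameBlock_le (k : ℕ) :
    sameBlock K H u w (k + 1) ≤ (sameBlock K H u w k).comap (boundary K H k) := by
  rw [sameBlock, Submodule.span_le]
  rintro _ ⟨f, hf, rfl⟩
  rw [SetLike.mem_coe, Submodule.mem_comap, boundary_cls]
  exact Submodule.sum_mem _ fun i _ => Submodule.smul_mem _ _
    (Submodule.subset_span ⟨merge i f, congrArg (mergeIdx k i) hf, rfl⟩)

/-- The chains of the quotient of `Δ(H)` by the partitions having `u` and `w` in one block. -/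
def QChain (k : ℕ) : Type _ := Chain K H k ⧸ sameBlock K H u w k

instance (k : ℕ) : AddCommGroup (QChain K H u w k) :=
  inferInstanceAs (AddCommGroup (Chain K H k ⧸ sameBlock K H u w k))

instance (k : ℕ) : Module K (QChain K H u w k) :=
  inferInstanceAs (Module K (Chain K H k ⧸ sameBlock K H u w k))

/-- The quotient map from the chains of `Δ(H)`. -/
def QChain.mk (k : ℕ) : Chain K H k →ₗ[K] QChain K H u w k := (sameBlock K H u w k).mkQ

/-- The boundary map of the quotient complex. -/
def qBoundary (k : ℕ) : QChain K H u w (k + 1) →ₗ[K] QChain K H u w k :=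
  Submodule.mapQ (sameBlock K H u w (k + 1)) (sameBlock K H u w k) (boundary K H k)
    (sameBlock_le K H u w k)

theorem qBoundary_qBoundary (k : ℕ) :
    qBoundary K H u w k ∘ₗ qBoundary K H u w (k + 1) = 0 := by
  apply Submodule.linearMap_qext (sameBlock K H u w (k + 2))
  refine LinearMap.ext fun c => ?_
  have := LinearMap.congr_fun (boundary_boundary K H k) c
  change QChain.mk K H u w k (boundary K H k (boundary K H (k + 1) c)) = 0
  rw [show boundary K H k (boundary K H (k + 1) c) = 0 from this, map_zero]

end Complex

section Homology

variable {K : Type*} [Field K] {C : ℕ → Type*} [∀ k, AddCommGroup (C k)] [∀ k, Module K (C k)]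

/-- The cycles of `⋯ → C 2 → C 1 → C 0 → 0`. -/
def cycles (d : ∀ k, C (k + 1) →ₗ[K] C k) : ∀ k, Submodule K (C k)
  | 0 => ⊤
  | k + 1 => LinearMap.ker (d k)

/-- Cycles modulo boundaries for `⋯ → C 2 → C 1 → C 0 → 0`. -/
def Homology (d : ∀ k, C (k + 1) →ₗ[K] C k) (k : ℕ) : Type _ :=
  ↥(cycles d k) ⧸ (LinearMap.range (d k)).submoduleOf (cycles d k)

instance (d : ∀ k, C (k + 1) →ₗ[K] C k) (k : ℕ) : AddCommGroup (Homology d k) :=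
  inferInstanceAs (AddCommGroup
    (↥(cycles d k) ⧸ (LinearMap.range (d k)).submoduleOf (cycles d k)))

instance (d : ∀ k, C (k + 1) →ₗ[K] C k) (k : ℕ) : Module K (Homology d k) :=
  inferInstanceAs (Module K
    (↥(cycles d k) ⧸ (LinearMap.range (d k)).submoduleOf (cycles d k)))

/-- The homology class of a cycle. -/
def homologyClass (d : ∀ k, C (k + 1) →ₗ[K] C k) (k : ℕ) : cycles d k →ₗ[K] Homology d k :=
  ((LinearMap.range (d k)).submoduleOf (cycles d k)).mkQ

end Homology

section Representatives

variable {n : ℕ}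

/-- For a vertex `o`: the sets `A` of vertices different from `o` such that exactly `k` vertices
lie outside `A ∪ {o}`. -/
def RepIndex (o : Fin n) (k : ℕ) : Type :=
  {A : Finset (Fin n) // o ∉ A ∧ A.card + (k + 1) = n}

/-- The vertices outside `A ∪ {o}`. -/
def RepIndex.rest {o : Fin n} {k : ℕ} (A : RepIndex o k) : Finset (Fin n) := (insert o A.1)ᶜ

theorem RepIndex.card_rest {o : Fin n} {k : ℕ} (A : RepIndex o k) : A.rest.card = k := by
  have h := A.2.2
  rw [RepIndex.rest, Finset.card_compl, Finset.card_insert_of_notMem A.2.1, Fintype.card_fin]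
  omega

/-- The ordered partition `(A ∪ {o}, {a_{σ(1)}}, …, {a_{σ(k)}})`, where `a_1 < ⋯ < a_k` are the
vertices outside `A ∪ {o}`. -/
def RepIndex.part {o : Fin n} {k : ℕ} (A : RepIndex o k) (σ : Equiv.Perm (Fin k)) :
    OrdPart (completeLooped n) (k + 1) :=
  ⟨fun v => if hv : v ∈ A.rest then
      (σ.symm ((A.rest.orderIsoOfFin A.card_rest).symm ⟨v, hv⟩)).succ else 0, by
    constructor
    · intro j
      refine Fin.cases ⟨o, ?_⟩ (fun i => ⟨A.rest.orderIsoOfFin A.card_rest (σ i), ?_⟩) j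
      · simp [RepIndex.rest]
      · beta_reduce
        rw [dif_pos (A.rest.orderIsoOfFin A.card_rest (σ i)).2]
        simp only [Subtype.coe_eta, OrderIso.symm_apply_apply, Equiv.symm_apply_apply]
    · exact ⟨{o}, Or.inl (Finset.card_singleton o), _, fun v hv => by
        rw [Finset.mem_singleton.1 hv]⟩⟩

/-- `∑_{σ ∈ S_k} sgn(σ) [A ∪ {o}, a_{σ(1)}, …, a_{σ(k)}]` as a chain of `Δ(E_n)`. -/
def repChain (K : Type*) [Field K] {o : Fin n} {k : ℕ} (A : RepIndex o k) :
    Chain K (completeLooped n) k :=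
  ∑ σ : Equiv.Perm (Fin k), ((Equiv.Perm.sign σ : ℤ) : K) • cls K (A.part σ)

/-- The image of `repChain` in the quotient complex. -/
def qRepChain (K : Type*) [Field K] {o : Fin n} (u w : Fin n) {k : ℕ} (A : RepIndex o k) :
    QChain K (completeLooped n) u w k :=
  QChain.mk K (completeLooped n) u w k (repChain K A)

end Representatives

section Main

variable (K : Type*) [Field K] {n : ℕ} (hn : 3 ≤ n)

/-- The vertex `1`. -/
def v₁ : Fin n := ⟨0, by omega⟩

/-- The vertex `2`. -/
def v₂ : Fin n := ⟨1, by omega⟩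

/-- The vertex `3`. -/
def v₃ : Fin n := ⟨2, by omega⟩

/-- The chains of `Δ(E_n^{(0,1)})` on partitions into `k + 1` blocks (degree `k - 1`). -/
abbrev Chain01 (k : ℕ) : Type _ := QChain K (completeLooped n) (v₂ hn) (v₃ hn) k

/-- The boundary map of `Δ(E_n^{(0,1)})`. -/
abbrev boundary01 (k : ℕ) : Chain01 K hn (k + 1) →ₗ[K] Chain01 K hn k :=
  qBoundary K (completeLooped n) (v₂ hn) (v₃ hn) k

/-- The homology of `Δ(E_n^{(0,1)})` in degree `k - 1`. -/
abbrev HC01 (k : ℕ) : Type _ := Homology (C := Chain01 K hn) (boundary01 K hn) k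

end Main

end CyclicColoring

end

open CyclicColoring

/-! Rotating the block of a fixed vertex `o` (vertex 1) to the front uses up the cyclic relation.
Chains of Δ(E_n) become combinations of functions that give each vertex its block index, with `o` at
index 0, and the boundary becomes an alternating sum of faces. This is the multilinear part of the
normalized Hochschild complex of the polynomial ring in the remaining n - 1 vertices, block 0 being
the coefficient slot. The representatives are the multilinear differential forms, and the argument
is a Hochschild-Kostant-Rosenberg computation by hand.

Spanning (`cycle_mem_sup`) is by induction on the set `W` of vertices allowed to leave block 0. For
a new vertex v the homotopy `moveBack` brings a cycle, up to a boundary, to the form a + (shuffle of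
v into b), with a and b not moving v (`moveBack_homotopy`). The two summands are independent and
shuffling anticommutes with the boundary, so a and b are cycles again; and shuffling v into an
alternating sum gives an alternating sum (`insSum_altSum`). Independence comes from the functionals
`detect`, which kill boundaries (`detect_faceSum`) and are dual to the representatives.

For the quotient by "u and w share a block" (u = 2, w = 3), forgetting w identifies the subcomplex
with the same complex on one vertex fewer. Its homology is therefore detected by the duals of the
representatives with w ∈ A (`exists_boundary_eq_of_mem_sameBlock`), and these duals extend to all of
Δ(E_n). So it injects into the homology of Δ(E_n), the connecting maps vanish, and the homology of
the quotient is the cokernel. There the classes with w ∈ A become combinations of the others, which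
form a basis. Counting the sets A that avoid both 1 and 3 gives the binomial coefficient. -/

noncomputable section

namespace CyclicColoring

/-! ### Faces, and the shuffle of one vertex into a chain -/

section Loday

variable (K : Type*) [Field K] {V : Type*}

/-- The effect of uniting the cyclically adjacent blocks `i` and `i + 1` of `k + 2` blocks on block
indices. -/
def face (k i x : ℕ) : ℕ := if x ≤ i then (if x ≤ k then x else 0) else x - 1

/-- The alternating sum of all faces, on block-index functions with values in `{0, …, k + 1}`. -/
def faceSum (k : ℕ) : ((V → ℕ) →₀ K) →ₗ[K] ((V → ℕ) →₀ K) :=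
  Finsupp.linearCombination K fun f =>
    ∑ i ∈ Finset.range (k + 2), (-1 : K) ^ i • Finsupp.single (face k i ∘ f) (1 : K)

theorem faceSum_single (k : ℕ) (f : V → ℕ) :
    faceSum K k (Finsupp.single f 1) =
      ∑ i ∈ Finset.range (k + 2), (-1 : K) ^ i • Finsupp.single (face k i ∘ f) (1 : K) := by
  simp [faceSum]

/-- Block-index functions of degree `k` in which all vertices outside `W` lie in block `0`. -/
def Proper (W : Finset V) (k : ℕ) (f : V → ℕ) : Prop :=
  (∀ x, x ∉ W → f x = 0) ∧ (∀ x, f x ≤ k) ∧ ∀ j, 0 < j → j ≤ k → ∃ x, f x = j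

/-- The chains spanned by the proper block-index functions. -/
def properChains (W : Finset V) (k : ℕ) : Submodule K ((V → ℕ) →₀ K) :=
  Submodule.span K {c | ∃ f, Proper W k f ∧ c = Finsupp.single f 1}

section

variable {K}

theorem single_mem_properChains {W : Finset V} {k : ℕ} {f : V → ℕ} (hf : Proper W k f) :
    Finsupp.single f (1 : K) ∈ properChains K W k :=
  Submodule.subset_span ⟨f, hf, rfl⟩

theorem properChains_induction {W : Finset V} {k : ℕ} {p : Submodule K ((V → ℕ) →₀ K)}
    (h : ∀ f, Proper W k f → Finsupp.single f 1 ∈ p) : properChains K W k ≤ p := by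
  rw [properChains, Submodule.span_le]
  rintro _ ⟨f, hf, rfl⟩
  exact h f hf

theorem Proper.face {W : Finset V} {k : ℕ} {f : V → ℕ} (hf : Proper W (k + 1) f) (i : ℕ) :
    Proper W k (face k i ∘ f) := by
  refine ⟨fun x hx => ?_, fun x => ?_, fun j hj hjk => ?_⟩
  · simp [CyclicColoring.face, hf.1 x hx]
  · have := hf.2.1 x
    simp only [Function.comp, CyclicColoring.face]
    split_ifs <;> omega
  · by_cases h : j ≤ i
    · obtain ⟨x, hx⟩ := hf.2.2 j hj (by omega)
      refine ⟨x, ?_⟩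
      simp only [Function.comp, CyclicColoring.face, hx]
      split_ifs; omega
    · obtain ⟨x, hx⟩ := hf.2.2 (j + 1) (by omega) (by omega)
      refine ⟨x, ?_⟩
      simp only [Function.comp, CyclicColoring.face, hx]
      split_ifs <;> omega

theorem Proper.mono {W W' : Finset V} (h : W ⊆ W') {k : ℕ} {f : V → ℕ} (hf : Proper W k f) :
    Proper W' k f :=
  ⟨fun x hx => hf.1 x fun hx' => hx (h hx'), hf.2⟩

theorem properChains_mono {W W' : Finset V} (h : W ⊆ W') (k : ℕ) :
    properChains K W k ≤ properChains K W' k :=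
  properChains_induction fun _ hf => single_mem_properChains (hf.mono h)

theorem faceSum_mem {W : Finset V} {k : ℕ} {c : (V → ℕ) →₀ K} (hc : c ∈ properChains K W (k + 1)) :
    faceSum K k c ∈ properChains K W k := by
  refine properChains_induction (p := (properChains K W k).comap (faceSum K k)) (fun f hf => ?_) hc
  rw [Submodule.mem_comap, faceSum_single]
  exact Submodule.sum_mem _ fun i _ => Submodule.smul_mem _ _
    (single_mem_properChains (hf.face i))

end

variable [DecidableEq V]

/-- Make `v` a block of its own, directly after block `i`. -/
def ins (v : V) (i : ℕ) (f : V → ℕ) : V → ℕ :=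
  fun x => if x = v then i + 1 else if f x ≤ i then f x else f x + 1

/-- The signed sum of all insertions of `v` into `k + 1` blocks. -/
def insSum (v : V) (k : ℕ) : ((V → ℕ) →₀ K) →ₗ[K] ((V → ℕ) →₀ K) :=
  Finsupp.linearCombination K fun f =>
    ∑ i ∈ Finset.range (k + 1), (-1 : K) ^ i • Finsupp.single (ins v i f) (1 : K)

theorem insSum_single (v : V) (k : ℕ) (f : V → ℕ) :
    insSum K v k (Finsupp.single f 1) =
      ∑ i ∈ Finset.range (k + 1), (-1 : K) ^ i • Finsupp.single (ins v i f) (1 : K) := by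
  simp [insSum]

open Classical in
/-- The homotopy moving `v` back to block `0`. -/
def moveBack (v : V) : ((V → ℕ) →₀ K) →ₗ[K] ((V → ℕ) →₀ K) :=
  Finsupp.linearCombination K fun f =>
    if ∃ x, x ≠ v ∧ f x = f v then
      -∑ i ∈ Finset.range (f v), (-1 : K) ^ i • Finsupp.single (ins v i f) (1 : K)
    else 0

theorem moveBack_single_of_shared {v : V} {f : V → ℕ} (h : ∃ x, x ≠ v ∧ f x = f v) :
    moveBack K v (Finsupp.single f 1) =
      -∑ i ∈ Finset.range (f v), (-1 : K) ^ i • Finsupp.single (ins v i f) (1 : K) := by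
  simp [moveBack, if_pos h]

theorem moveBack_single_of_alone {v : V} {f : V → ℕ} (h : ¬ ∃ x, x ≠ v ∧ f x = f v) :
    moveBack K v (Finsupp.single f 1) = 0 := by
  simp only [moveBack, Finsupp.linearCombination_single, if_neg h, smul_zero]

theorem ins_congr {v : V} {i : ℕ} {f g : V → ℕ} (h : ∀ x, x ≠ v → f x = g x) :
    ins v i f = ins v i g := by
  funext x
  by_cases hx : x = v
  · simp [ins, hx]
  · simp [ins, hx, h x hx]

section Faces

variable {v : V} {k i : ℕ} {f : V → ℕ}

theorem face_ins_lt {l : ℕ} (hl : l < i) (hi : i ≤ k + 1) (hf : ∀ x, f x ≤ k + 1) :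
    face (k + 1) l ∘ ins v i f = ins v (i - 1) (face k l ∘ f) := by
  funext x
  have := hf x
  simp only [Function.comp, face, ins]
  split_ifs <;> omega

theorem face_ins_self (hf : ∀ x, f x ≤ k) :
    face k i ∘ ins v i f = Function.update f v i := by
  funext x
  have := hf x
  by_cases hx : x = v
  · simp [face, ins, hx]
  · simp only [Function.comp, face, ins, hx, Function.update_of_ne hx, if_false]
    split_ifs <;> omega

theorem face_ins_succ (hf : ∀ x, f x ≤ k) :
    face k (i + 1) ∘ ins v i f = Function.update f v (if i + 1 ≤ k then i + 1 else 0) := by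
  funext x
  have := hf x
  by_cases hx : x = v
  · simp [face, ins, hx]
  · simp only [Function.comp, face, ins, hx, Function.update_of_ne hx, if_false]
    split_ifs <;> omega

theorem face_ins_gt {m : ℕ} (hm : i < m) (hmk : m ≤ k + 1) (hf : ∀ x, f x ≤ k + 1) :
    face (k + 1) (m + 1) ∘ ins v i f = ins v i (face k m ∘ f) := by
  funext x
  have := hf x
  simp only [Function.comp, face, ins]
  split_ifs <;> omega

end Faces

/-- Two faces unite the singleton block of `v` with its left and right neighbours; every other face
acts on `f` and leaves `v` a block of its own. The value 0 in the second update is the cyclic case,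
where the right neighbour of the last block is block 0. -/
theorem faceSum_ins {v : V} {k i : ℕ} {f : V → ℕ} (hi : i ≤ k + 1) (hf : ∀ x, f x ≤ k + 1) :
    faceSum K (k + 1) (Finsupp.single (ins v i f) 1) =
      (-1 : K) ^ i • (Finsupp.single (Function.update f v i) 1 -
        Finsupp.single (Function.update f v (if i + 1 ≤ k + 1 then i + 1 else 0)) 1) +
      ∑ l ∈ Finset.range i, (-1 : K) ^ l • Finsupp.single (ins v (i - 1) (face k l ∘ f)) 1 -
      ∑ p ∈ Finset.range (k + 1 - i),
        (-1 : K) ^ (i + 1 + p) • Finsupp.single (ins v i (face k (i + 1 + p) ∘ f)) 1 := by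
  obtain ⟨m, hm⟩ : ∃ m, k + 1 = i + m := ⟨k + 1 - i, by omega⟩
  rw [faceSum_single, show k + 1 + 2 = i + (m + 2) by omega, Finset.sum_range_add,
    Finset.sum_range_succ', Finset.sum_range_succ', show k + 1 - i = m by omega]
  have h1 : ∑ l ∈ Finset.range i, (-1 : K) ^ l • Finsupp.single (face (k + 1) l ∘ ins v i f) (1 : K)
      = ∑ l ∈ Finset.range i, (-1 : K) ^ l • Finsupp.single (ins v (i - 1) (face k l ∘ f)) 1 :=
    Finset.sum_congr rfl fun l hl => by
      rw [face_ins_lt (Finset.mem_range.1 hl) hi hf]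
  have h2 : ∑ p ∈ Finset.range m, (-1 : K) ^ (i + (p + 1 + 1)) •
        Finsupp.single (face (k + 1) (i + (p + 1 + 1)) ∘ ins v i f) (1 : K)
      = -∑ p ∈ Finset.range m,
        (-1 : K) ^ (i + 1 + p) • Finsupp.single (ins v i (face k (i + 1 + p) ∘ f)) 1 := by
    rw [← Finset.sum_neg_distrib]
    refine Finset.sum_congr rfl fun p hp => ?_
    have := Finset.mem_range.1 hp
    rw [show i + (p + 1 + 1) = (i + 1 + p) + 1 by omega,
      face_ins_gt (by omega) (by omega) hf, pow_succ]
    simp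
  rw [h1, h2, add_zero, face_ins_self hf, zero_add, face_ins_succ hf, pow_succ]
  simp only [mul_neg, mul_one, neg_smul, smul_sub]
  abel

/-- The terms that reunite `v` with a neighbour telescope, leaving `v` in block 0 minus `v` in block
`j`. Among the remaining terms, a face to the left of position `j` unites two of the gaps available
to `v`, hence the `j - 1`. The partial sums serve the homotopy, and `j = k + 2` is the full shuffle.
-/
theorem sum_faceSum_ins {v : V} {k : ℕ} {f : V → ℕ} (hf : ∀ x, f x ≤ k + 1) (j : ℕ)
    (hj : j ≤ k + 2) :
    ∑ i ∈ Finset.range j, (-1 : K) ^ i • faceSum K (k + 1) (Finsupp.single (ins v i f) 1) =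
      Finsupp.single (Function.update f v 0) 1 -
        Finsupp.single (Function.update f v (if j ≤ k + 1 then j else 0)) 1 -
      ∑ l ∈ Finset.range (k + 2), ∑ i ∈ Finset.range (if l < j then j - 1 else j),
        (-1 : K) ^ l • (-1 : K) ^ i • Finsupp.single (ins v i (face k l ∘ f)) 1 := by
  induction j with
  | zero => simp
  | succ j ih =>
    rw [Finset.sum_range_succ, ih (by omega), faceSum_ins K (by omega) hf]
    obtain ⟨m, hm⟩ : ∃ m, k + 1 = j + m := ⟨k + 1 - j, by omega⟩
    have split : ∀ g : ℕ → ((V → ℕ) →₀ K), ∑ l ∈ Finset.range (k + 2), g l =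
        ∑ l ∈ Finset.range j, g l + g j + ∑ p ∈ Finset.range m, g (j + 1 + p) := by
      intro g
      rw [show k + 2 = j + 1 + m by omega, Finset.sum_range_add, Finset.sum_range_succ]
    rw [split, split, show k + 1 - j = m by omega, if_pos (show j ≤ k + 1 by omega)]
    have e1 : ∑ l ∈ Finset.range j, ∑ i ∈ Finset.range (if l < j + 1 then j + 1 - 1 else j + 1),
        (-1 : K) ^ l • (-1 : K) ^ i • Finsupp.single (ins v i (face k l ∘ f)) (1 : K) =
        ∑ l ∈ Finset.range j, ∑ i ∈ Finset.range (if l < j then j - 1 else j),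
        (-1 : K) ^ l • (-1 : K) ^ i • Finsupp.single (ins v i (face k l ∘ f)) 1 -
        (-1 : K) ^ j • ∑ l ∈ Finset.range j,
          (-1 : K) ^ l • Finsupp.single (ins v (j - 1) (face k l ∘ f)) 1 := by
      rw [Finset.smul_sum, ← Finset.sum_sub_distrib]
      refine Finset.sum_congr rfl fun l hl => ?_
      have := Finset.mem_range.1 hl
      obtain ⟨q, rfl⟩ : ∃ q, j = q + 1 := ⟨j - 1, by omega⟩
      rw [if_pos (by omega), if_pos this, Nat.add_sub_cancel, Nat.add_sub_cancel,
        Finset.sum_range_succ, smul_comm ((-1 : K) ^ (q + 1)), pow_succ]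
      simp
    have e2 : ∑ p ∈ Finset.range m,
        ∑ i ∈ Finset.range (if j + 1 + p < j + 1 then j + 1 - 1 else j + 1),
        (-1 : K) ^ (j + 1 + p) • (-1 : K) ^ i •
          Finsupp.single (ins v i (face k (j + 1 + p) ∘ f)) (1 : K) =
        ∑ p ∈ Finset.range m, ∑ i ∈ Finset.range (if j + 1 + p < j then j - 1 else j),
        (-1 : K) ^ (j + 1 + p) • (-1 : K) ^ i •
          Finsupp.single (ins v i (face k (j + 1 + p) ∘ f)) 1 +
        (-1 : K) ^ j • ∑ p ∈ Finset.range m,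
          (-1 : K) ^ (j + 1 + p) • Finsupp.single (ins v j (face k (j + 1 + p) ∘ f)) 1 := by
      rw [Finset.smul_sum, ← Finset.sum_add_distrib]
      refine Finset.sum_congr rfl fun p _ => ?_
      rw [if_neg (by omega), if_neg (by omega), Finset.sum_range_succ, smul_comm ((-1 : K) ^ j)]
    rw [e1, e2, if_pos (show j < j + 1 by omega), if_neg (show ¬ j < j by omega),
      Nat.add_sub_cancel]
    have e3 : (-1 : K) ^ j * (-1 : K) ^ j = 1 := by rw [← mul_pow]; simp
    simp only [smul_sub, smul_add, smul_smul ((-1 : K) ^ j) ((-1 : K) ^ j), e3, one_smul]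
    abel

/-- For the full shuffle the telescoped ends cancel, since `v` has gone once around the cycle back
to block 0. -/
theorem faceSum_insSum_single (v : V) {k : ℕ} {f : V → ℕ} (hf : ∀ x, f x ≤ k + 1) :
    faceSum K (k + 1) (insSum K v (k + 1) (Finsupp.single f 1)) =
      -insSum K v k (faceSum K k (Finsupp.single f 1)) := by
  have h := sum_faceSum_ins K (v := v) hf (k + 2) le_rfl
  rw [insSum_single, faceSum_single]
  simp only [map_sum, map_smul]
  rw [h, if_neg (by omega), sub_self, zero_sub]
  congr 1
  refine Finset.sum_congr rfl fun l hl => ?_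
  rw [if_pos (Finset.mem_range.1 hl), insSum_single, Finset.smul_sum]
  rfl

theorem faceSum_insSum_zero (v : V) (f : V → ℕ) (hf : ∀ x, f x ≤ 0) :
    faceSum K 0 (insSum K v 0 (Finsupp.single f 1)) = 0 := by
  rw [insSum_single, map_sum, Finset.sum_range_one, map_smul, faceSum_single,
    Finset.sum_range_succ, Finset.sum_range_one, face_ins_self hf, face_ins_succ hf]
  simp

variable {K}

theorem Proper.ins {W : Finset V} {k : ℕ} {f : V → ℕ} {v : V} (hv : v ∉ W) (hf : Proper W k f)
    {i : ℕ} (hi : i ≤ k) : Proper (insert v W) (k + 1) (ins v i f) := by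
  refine ⟨fun x hx => ?_, fun x => ?_, fun j hj hjk => ?_⟩
  · rw [Finset.mem_insert, not_or] at hx
    simp [CyclicColoring.ins, hx.1, hf.1 x hx.2]
  · have := hf.2.1 x
    simp only [CyclicColoring.ins]
    split_ifs <;> omega
  · have ne : ∀ x, f x ≠ 0 → x ≠ v := fun x hx h => hx (h ▸ hf.1 v hv)
    rcases lt_trichotomy j (i + 1) with h | h | h
    · obtain ⟨x, hx⟩ := hf.2.2 j hj (by omega)
      refine ⟨x, ?_⟩
      simp only [CyclicColoring.ins, if_neg (ne x (by omega)), hx]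
      split_ifs <;> omega
    · exact ⟨v, by simp [CyclicColoring.ins, h]⟩
    · obtain ⟨x, hx⟩ := hf.2.2 (j - 1) (by omega) (by omega)
      refine ⟨x, ?_⟩
      simp only [CyclicColoring.ins, if_neg (ne x (by omega)), hx]
      split_ifs <;> omega

theorem insSum_mem {W : Finset V} {k : ℕ} {v : V} (hv : v ∉ W) {c : (V → ℕ) →₀ K}
    (hc : c ∈ properChains K W k) : insSum K v k c ∈ properChains K (insert v W) (k + 1) := by
  refine properChains_induction
    (p := (properChains K (insert v W) (k + 1)).comap (insSum K v k)) (fun f hf => ?_) hc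
  rw [Submodule.mem_comap, insSum_single]
  exact Submodule.sum_mem _ fun i hi => Submodule.smul_mem _ _ (single_mem_properChains
    (hf.ins hv (Nat.lt_succ_iff.1 (Finset.mem_range.1 hi))))

theorem faceSum_insSum (v : V) {W : Finset V} {k : ℕ} {c : (V → ℕ) →₀ K}
    (hc : c ∈ properChains K W (k + 1)) :
    faceSum K (k + 1) (insSum K v (k + 1) c) = -insSum K v k (faceSum K k c) := by
  have := properChains_induction (p := LinearMap.ker
    (faceSum K (k + 1) ∘ₗ insSum K v (k + 1) + insSum K v k ∘ₗ faceSum K k)) (fun f hf => ?_) hc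
  · exact eq_neg_of_add_eq_zero_left this
  · rw [LinearMap.mem_ker, LinearMap.add_apply, LinearMap.comp_apply, LinearMap.comp_apply,
      faceSum_insSum_single K v hf.2.1, neg_add_cancel]

theorem faceSum_insSum_degree_zero (v : V) {W : Finset V} {c : (V → ℕ) →₀ K}
    (hc : c ∈ properChains K W 0) : faceSum K 0 (insSum K v 0 c) = 0 :=
  properChains_induction (p := LinearMap.ker (faceSum K 0 ∘ₗ insSum K v 0))
    (fun f hf => faceSum_insSum_zero K v f hf.2.1) hc

end Loday

/-! ### The homotopy that returns a vertex to block 0 -/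

section Homotopy

variable {K : Type*} [Field K] {V : Type*} [DecidableEq V]

theorem neg_one_pow_mul_self (i : ℕ) : (-1 : K) ^ i * (-1 : K) ^ i = 1 := by
  rw [← mul_pow]; simp

theorem Proper.update_zero {W : Finset V} {v : V} {k : ℕ} {f : V → ℕ}
    (hf : Proper (insert v W) k f) (h : ∃ x, x ≠ v ∧ f x = f v) :
    Proper W k (Function.update f v 0) := by
  refine ⟨fun x hx => ?_, fun x => ?_, fun j hj hjk => ?_⟩
  · by_cases hxv : x = v
    · simp [hxv]
    · rw [Function.update_of_ne hxv]
      exact hf.1 x (by simp [hxv, hx])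
  · by_cases hxv : x = v
    · simp [hxv]
    · rw [Function.update_of_ne hxv]
      exact hf.2.1 x
  · obtain ⟨x, hx⟩ := hf.2.2 j hj hjk
    by_cases hxv : x = v
    · obtain ⟨y, hy, hyv⟩ := h
      exact ⟨y, by rw [Function.update_of_ne hy, hyv, ← hxv, hx]⟩
    · exact ⟨x, by rw [Function.update_of_ne hxv, hx]⟩

/-- The block-index functions in which `v` lies in block `0` are proper on the smaller set. -/
theorem Proper.of_insert {W : Finset V} {v : V} {k : ℕ} {f : V → ℕ}
    (hf : Proper (insert v W) k f) (h : f v = 0) : Proper W k f := by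
  refine ⟨fun x hx => ?_, hf.2⟩
  by_cases hxv : x = v
  · rw [hxv, h]
  · exact hf.1 x (by simp [hxv, hx])

omit [DecidableEq V] in
theorem face_eq_face_succ {v : V} {k j : ℕ} {f : V → ℕ} (hj : j ≤ k) (hf : ∀ x, f x ≤ k + 1)
    (hv : f v = j + 1) (h : ¬ ∃ x, x ≠ v ∧ f x = f v) (x : V) (hx : x ≠ v) :
    (face k j ∘ f) x = (face k (j + 1) ∘ f) x := by
  have h1 : f x ≠ j + 1 := fun h' => h ⟨x, hx, by rw [h', hv]⟩
  have := hf x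
  simp only [Function.comp, face]
  split_ifs <;> omega

theorem ins_face_self {v : V} {k j : ℕ} {f : V → ℕ} (hj : j ≤ k) (hf : ∀ x, f x ≤ k + 1)
    (hv : f v = j + 1) (h : ¬ ∃ x, x ≠ v ∧ f x = f v) :
    ins v j (face k (j + 1) ∘ f) = f := by
  funext x
  by_cases hx : x = v
  · simp [ins, hx, hv]
  · have h1 : f x ≠ j + 1 := fun h' => h ⟨x, hx, by rw [h', hv]⟩
    have := hf x
    simp only [Function.comp, face, ins, hx, if_false]
    split_ifs <;> omega

/-- By `sum_faceSum_ins`, walking `v` back from its block to block 0 replaces `f` by its version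
with `v` in block 0, up to insertions into faces of `f`. These cancel against the homotopy applied
to the faces, except possibly for the cyclic face. -/
theorem moveBack_homotopy_of_shared {W : Finset V} {v : V} {k : ℕ} {f : V → ℕ}
    (hf : Proper (insert v W) (k + 1) f) (h : ∃ x, x ≠ v ∧ f x = f v) :
    ∃ b ∈ properChains K W k,
      Finsupp.single f 1 - faceSum K (k + 1) (moveBack K v (Finsupp.single f 1)) -
        moveBack K v (faceSum K k (Finsupp.single f 1)) =
      Finsupp.single (Function.update f v 0) 1 + insSum K v k b := by
  have hface : ∀ l, ∃ x, x ≠ v ∧ (face k l ∘ f) x = (face k l ∘ f) v := fun l => by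
    obtain ⟨x, hx, hxv⟩ := h
    exact ⟨x, hx, by simp [hxv]⟩
  have hv := hf.2.1 v
  have h1 : faceSum K (k + 1) (moveBack K v (Finsupp.single f 1)) =
      -(Finsupp.single (Function.update f v 0) 1 - Finsupp.single f 1 -
      ∑ l ∈ Finset.range (k + 2), ∑ i ∈ Finset.range (if l < f v then f v - 1 else f v),
        (-1 : K) ^ l • (-1 : K) ^ i • Finsupp.single (ins v i (face k l ∘ f)) 1) := by
    rw [moveBack_single_of_shared K h]
    simp only [map_neg, map_sum, map_smul]
    rw [sum_faceSum_ins K hf.2.1 (f v) (by omega), if_pos hv, Function.update_eq_self]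
  have h2 : moveBack K v (faceSum K k (Finsupp.single f 1)) =
      -∑ l ∈ Finset.range (k + 2), ∑ i ∈ Finset.range (face k l (f v)),
        (-1 : K) ^ l • (-1 : K) ^ i • Finsupp.single (ins v i (face k l ∘ f)) 1 := by
    rw [faceSum_single, ← Finset.sum_neg_distrib]
    simp only [map_sum, map_smul]
    refine Finset.sum_congr rfl fun l _ => ?_
    rw [moveBack_single_of_shared K (hface l), smul_neg, Finset.smul_sum]
    rfl
  rw [h1, h2, Finset.sum_range_succ, Finset.sum_range_succ (n := k + 1)]
  have h3 : ∑ l ∈ Finset.range (k + 1), ∑ i ∈ Finset.range (face k l (f v)),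
        (-1 : K) ^ l • (-1 : K) ^ i • Finsupp.single (ins v i (face k l ∘ f)) (1 : K) =
      ∑ l ∈ Finset.range (k + 1), ∑ i ∈ Finset.range (if l < f v then f v - 1 else f v),
        (-1 : K) ^ l • (-1 : K) ^ i • Finsupp.single (ins v i (face k l ∘ f)) 1 := by
    refine Finset.sum_congr rfl fun l hl => ?_
    have := Finset.mem_range.1 hl
    congr 2
    simp only [face]
    split_ifs <;> omega
  rw [h3]
  -- Only if `v` lies in the last block does the cyclic face send it to index 0, where the homotopy
  -- contributes nothing; the uncancelled insertions then form a full shuffle into that face.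
  by_cases hk : f v = k + 1
  · refine ⟨-(-1 : K) ^ (k + 1) • Finsupp.single (face k (k + 1) ∘ f) 1,
      Submodule.smul_mem _ _ (single_mem_properChains ((hf.face (k + 1)).of_insert ?_)), ?_⟩
    · simp [face, hk]
    · rw [map_smul, insSum_single, hk, if_neg (by omega)]
      simp only [face, le_refl, if_true, if_neg (show ¬ k + 1 ≤ k by omega), Finset.range_zero,
        Finset.sum_empty, neg_smul, ← Finset.smul_sum, smul_zero]
      abel
  · refine ⟨0, Submodule.zero_mem _, ?_⟩
    rw [if_neg (by omega), show face k (k + 1) (f v) = f v by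
      simp only [face]; split_ifs <;> omega, map_zero]
    abel

/-- Only the two faces that unite `v` with a neighbour make it share a block, and they agree away
from `v`. Their homotopy terms differ by the single insertion that restores `f`, unless `v` is the
last block, in which case `f` completes a full shuffle. -/
theorem moveBack_homotopy_of_alone {W : Finset V} {v o : V} (ho : o ∉ insert v W) {k : ℕ}
    {f : V → ℕ} (hf : Proper (insert v W) (k + 1) f) (h : ¬ ∃ x, x ≠ v ∧ f x = f v) :
    ∃ b ∈ properChains K W k,
      Finsupp.single f 1 - moveBack K v (faceSum K k (Finsupp.single f 1)) = insSum K v k b := by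
  have hov : o ≠ v := fun h => ho (by simp [h])
  have hfo : f o = 0 := hf.1 o ho
  obtain ⟨j, hj⟩ : ∃ j, f v = j + 1 :=
    ⟨f v - 1, by
      have : f v ≠ 0 := fun h0 => h ⟨o, hov, by rw [hfo, h0]⟩
      omega⟩
  have hjk : j ≤ k := by have := hf.2.1 v; omega
  -- Every other face leaves `v` alone in its block, where the homotopy is zero.
  have h0 : ∀ l ∈ Finset.range (k + 2), l ∉ ({j, j + 1} : Finset ℕ) →
      (-1 : K) ^ l • moveBack K v (Finsupp.single (face k l ∘ f) 1) = 0 := by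
    intro l hl hlj
    rw [Finset.mem_insert, Finset.mem_singleton, not_or] at hlj
    have := Finset.mem_range.1 hl
    rw [moveBack_single_of_alone, smul_zero]
    rintro ⟨x, hx, hxv⟩
    have h1 : f x ≠ j + 1 := fun h' => h ⟨x, hx, by rw [h', hj]⟩
    have := hf.2.1 x
    simp only [Function.comp, face, hj] at hxv
    split_ifs at hxv <;> omega
  have s1 : ∃ x, x ≠ v ∧ (face k j ∘ f) x = (face k j ∘ f) v := by
    obtain ⟨x, hx, hxv⟩ : ∃ x, x ≠ v ∧ f x = j := by
      rcases Nat.eq_zero_or_pos j with h' | h'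
      · exact ⟨o, hov, by rw [hfo, h']⟩
      · obtain ⟨x, hx⟩ := hf.2.2 j h' (by omega)
        exact ⟨x, fun hxv => by rw [hxv] at hx; omega, hx⟩
    refine ⟨x, hx, ?_⟩
    simp only [Function.comp, face, hj, hxv]
    split_ifs <;> omega
  have s2 : ∃ x, x ≠ v ∧ (face k (j + 1) ∘ f) x = (face k (j + 1) ∘ f) v := by
    -- The right neighbour is block `j + 2`, or, when `v` is the last block, block 0 with the vertex
    -- `o`.
    rcases hjk.lt_or_eq with h' | h'
    · obtain ⟨x, hx⟩ := hf.2.2 (j + 2) (by omega) (by omega)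
      refine ⟨x, fun hxv => by rw [hxv] at hx; omega, ?_⟩
      simp only [Function.comp, face, hj, hx]
      split_ifs <;> omega
    · refine ⟨o, hov, ?_⟩
      simp only [Function.comp, face, hj, hfo]
      split_ifs <;> omega
  have e1 : moveBack K v (faceSum K k (Finsupp.single f 1)) =
      -((-1 : K) ^ j • ∑ i ∈ Finset.range j,
        (-1 : K) ^ i • Finsupp.single (ins v i (face k (j + 1) ∘ f)) 1) +
      (-1 : K) ^ j • ∑ i ∈ Finset.range (face k (j + 1) (j + 1)),
        (-1 : K) ^ i • Finsupp.single (ins v i (face k (j + 1) ∘ f)) 1 := by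
    rw [faceSum_single]
    simp only [map_sum, map_smul]
    rw [← Finset.sum_subset (s₁ := {j, j + 1}) (fun x hx => ?_) h0,
      Finset.sum_pair (by omega), moveBack_single_of_shared K s1, moveBack_single_of_shared K s2]
    · simp only [Function.comp_apply (g := f), hj, ins_congr (face_eq_face_succ hjk hf.2.1 hj h)]
      rw [show face k j (j + 1) = j by simp [face], pow_succ]
      simp
    · rw [Finset.mem_insert, Finset.mem_singleton] at hx
      rw [Finset.mem_range]
      omega
  have e2 := neg_one_pow_mul_self (K := K) j
  rw [e1]
  rcases hjk.lt_or_eq with h' | rfl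
  · refine ⟨0, Submodule.zero_mem _, ?_⟩
    rw [show face k (j + 1) (j + 1) = j + 1 by simp [face]; omega, Finset.sum_range_succ, smul_add,
      smul_smul ((-1 : K) ^ j) ((-1 : K) ^ j), e2, one_smul, ins_face_self hjk hf.2.1 hj h]
    simp
  · refine ⟨(-1 : K) ^ j • Finsupp.single (face j (j + 1) ∘ f) 1,
      Submodule.smul_mem _ _ (single_mem_properChains ((hf.face (j + 1)).of_insert ?_)), ?_⟩
    · simp [face, hj]
    · rw [show face j (j + 1) (j + 1) = 0 by simp [face], map_smul, insSum_single,
        Finset.sum_range_succ, smul_add, smul_smul ((-1 : K) ^ j) ((-1 : K) ^ j), e2, one_smul,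
        ins_face_self hjk hf.2.1 hj h]
      simp [add_comm]

theorem moveBack_mem {W : Finset V} {v : V} (hv : v ∉ W) {k : ℕ} {c : (V → ℕ) →₀ K}
    (hc : c ∈ properChains K (insert v W) k) :
    moveBack K v c ∈ properChains K (insert v W) (k + 1) := by
  refine properChains_induction
    (p := (properChains K (insert v W) (k + 1)).comap (moveBack K v)) (fun f hf => ?_) hc
  rw [Submodule.mem_comap]
  by_cases h : ∃ x, x ≠ v ∧ f x = f v
  · rw [moveBack_single_of_shared K h]
    refine Submodule.neg_mem _ (Submodule.sum_mem _ fun i hi => Submodule.smul_mem _ _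
      (single_mem_properChains ?_))
    -- Insertion ignores the old index of `v`. With `v` sent to block 0 no block is emptied, so the
    -- function is proper on `W`.
    rw [ins_congr (g := Function.update f v 0) fun x hx => (Function.update_of_ne hx _ _).symm]
    have := hf.2.1 v
    exact (hf.update_zero h).ins hv (by have := Finset.mem_range.1 hi; omega)
  · rw [moveBack_single_of_alone K h]
    exact Submodule.zero_mem _

theorem moveBack_homotopy {W : Finset V} {v o : V} (ho : o ∉ insert v W) {k : ℕ}
    {c : (V → ℕ) →₀ K} (hc : c ∈ properChains K (insert v W) (k + 1)) :
    ∃ a ∈ properChains K W (k + 1), ∃ b ∈ properChains K W k,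
      c - faceSum K (k + 1) (moveBack K v c) - moveBack K v (faceSum K k c) =
        a + insSum K v k b := by
  have := properChains_induction (p := (properChains K W (k + 1) ⊔
    (properChains K W k).map (insSum K v k)).comap
    (LinearMap.id - faceSum K (k + 1) ∘ₗ moveBack K v - moveBack K v ∘ₗ faceSum K k))
    (fun f hf => ?_) hc
  · obtain ⟨a, ha, _, ⟨b, hb, rfl⟩, h⟩ := Submodule.mem_sup.1 this
    exact ⟨a, ha, b, hb, h.symm⟩
  · rw [Submodule.mem_comap]
    simp only [LinearMap.sub_apply, LinearMap.comp_apply, LinearMap.id_apply]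
    by_cases h : ∃ x, x ≠ v ∧ f x = f v
    · obtain ⟨b, hb, e⟩ := moveBack_homotopy_of_shared (K := K) hf h
      rw [e]
      exact Submodule.add_mem_sup (single_mem_properChains (hf.update_zero h)) ⟨b, hb, rfl⟩
    · obtain ⟨b, hb, e⟩ := moveBack_homotopy_of_alone (K := K) ho hf h
      rw [moveBack_single_of_alone K h, map_zero, sub_zero, e]
      exact Submodule.mem_sup_right ⟨b, hb, rfl⟩

/-- The proper chains with `v` in block `0` and the insertions of `v` are independent. -/
theorem eq_zero_of_add_insSum_eq_zero {W : Finset V} {v : V} (hv : v ∉ W) {k : ℕ}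
    {a b : (V → ℕ) →₀ K} (ha : a ∈ properChains K W (k + 1)) (hb : b ∈ properChains K W k)
    (h : a + insSum K v k b = 0) : a = 0 ∧ b = 0 := by
  -- A left inverse of the shuffle: keep the functions with `v` in block 1 and lower all indices.
  -- Only the insertion at `i = 0` survives, and functions with `v` in block 0 are killed.
  let p : ((V → ℕ) →₀ K) →ₗ[K] ((V → ℕ) →₀ K) :=
    Finsupp.linearCombination K fun f => if f v = 1 then Finsupp.single (Nat.pred ∘ f) 1 else 0
  have hpa : p a = 0 := properChains_induction (p := LinearMap.ker p) (fun f hf => by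
    simp [p, hf.1 v hv]) ha
  have hpb : p (insSum K v k b) = b := by
    refine properChains_induction
      (p := LinearMap.eqLocus (p ∘ₗ insSum K v k) LinearMap.id) (fun f hf => ?_) hb
    rw [LinearMap.mem_eqLocus, LinearMap.comp_apply, insSum_single, map_sum,
      Finset.sum_range_succ', Finset.sum_eq_zero fun i _ => by simp [p, ins]]
    have : Nat.pred ∘ ins v 0 f = f := by
      funext x
      by_cases hx : x = v
      · simp [ins, hx, hf.1 v hv]
      · simp only [Function.comp, ins, hx, if_false, Nat.pred_eq_sub_one]
        split_ifs <;> omega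
    simp only [map_smul, p, Finsupp.linearCombination_single, one_smul, this]
    simp [ins]
  have hb0 : b = 0 := by
    have := congrArg p h
    rwa [map_add, hpa, zero_add, hpb, map_zero] at this
  rw [hb0, map_zero, add_zero] at h
  exact ⟨h, hb0⟩

omit [DecidableEq V] in
theorem face_face {k i j : ℕ} (hij : i < j) (hj : j ≤ k + 2) {f : V → ℕ} (hf : ∀ x, f x ≤ k + 2) :
    face k i ∘ face (k + 1) j ∘ f = face k (j - 1) ∘ face (k + 1) i ∘ f := by
  funext x
  have := hf x
  simp only [Function.comp, face]
  by_cases c1 : f x ≤ i <;> by_cases c2 : f x ≤ j <;> by_cases c3 : f x ≤ k + 1 <;>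
    simp only [c1, c2, c3, if_true, if_false] <;> split_ifs <;> omega

omit [DecidableEq V] in
theorem faceSum_faceSum {W : Finset V} {k : ℕ} {c : (V → ℕ) →₀ K}
    (hc : c ∈ properChains K W (k + 2)) : faceSum K k (faceSum K (k + 1) c) = 0 := by
  suffices key : properChains K W (k + 2) ≤ LinearMap.ker (faceSum K k ∘ₗ faceSum K (k + 1)) by
    exact LinearMap.mem_ker.1 (key hc)
  refine properChains_induction fun f hf => ?_
  rw [LinearMap.mem_ker, LinearMap.comp_apply, faceSum_single]
  simp only [map_sum, map_smul, faceSum_single, Finset.smul_sum, smul_smul]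
  rw [← Finset.sum_product']
  refine Finset.sum_involution
    (fun p _ => if p.2 < p.1 then (p.2, p.1 - 1) else (p.2 + 1, p.1)) ?_ ?_ ?_ ?_
  · rintro ⟨j, i⟩ hp
    simp only [Finset.mem_product, Finset.mem_range] at hp
    by_cases h : i < j
    · obtain ⟨m, rfl⟩ : ∃ m, j = m + 1 := ⟨j - 1, by omega⟩
      simp only [h, if_true, face_face h (by omega : m + 1 ≤ k + 2) hf.2.1, Nat.add_sub_cancel]
      rw [← add_smul, show (-1 : K) ^ (m + 1) * (-1) ^ i + (-1) ^ i * (-1) ^ m = 0 by ring,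
        zero_smul]
    · simp only [h, if_false,
        face_face (show j < i + 1 by omega) (by omega : i + 1 ≤ k + 2) hf.2.1, Nat.add_sub_cancel]
      rw [← add_smul, show (-1 : K) ^ j * (-1) ^ i + (-1) ^ (i + 1) * (-1) ^ j = 0 by ring,
        zero_smul]
  · rintro ⟨j, i⟩ - -
    dsimp only
    split_ifs <;> simp only [ne_eq, Prod.mk.injEq] <;> omega
  · rintro ⟨j, i⟩ hp
    simp only [Finset.mem_product, Finset.mem_range] at hp
    dsimp only
    split_ifs <;> simp only [Finset.mem_product, Finset.mem_range] <;> omega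
  · rintro ⟨j, i⟩ -
    by_cases h : i < j
    · simp only [h, if_true, show ¬ j - 1 < i by omega, if_false, Prod.mk.injEq, and_true]
      omega
    · simp only [h, if_false, show j < i + 1 by omega, if_true, Nat.add_sub_cancel]

end Homotopy

/-! ### Alternating sums span the homology -/

section Shuffle

variable (K : Type*) [Field K] {V : Type*} [DecidableEq V]

/-- The block-index function sending `e m` to `π m + 1` and everything else to `0`. -/
def label {k : ℕ} (e : Fin k → V) (π : Equiv.Perm (Fin k)) (x : V) : ℕ :=
  if h : ∃ m, e m = x then (π h.choose : ℕ) + 1 else 0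

/-- The alternating sum of all labellings. -/
def altSum {k : ℕ} (e : Fin k → V) : (V → ℕ) →₀ K :=
  ∑ π : Equiv.Perm (Fin k), ((Equiv.Perm.sign π : ℤ) : K) • Finsupp.single (label e π) 1

section

variable {k : ℕ} {e : Fin k → V}

theorem label_apply (he : Function.Injective e) (π : Equiv.Perm (Fin k)) (m : Fin k) :
    label e π (e m) = π m + 1 := by
  have h : ∃ m', e m' = e m := ⟨m, rfl⟩
  rw [label, dif_pos h, he h.choose_spec]

theorem label_of_notMem (π : Equiv.Perm (Fin k)) {x : V} (hx : ∀ m, e m ≠ x) :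
    label e π x = 0 :=
  dif_neg fun ⟨m, hm⟩ => hx m hm

theorem label_comp (he : Function.Injective e) (τ π : Equiv.Perm (Fin k)) :
    label (e ∘ τ) π = label e (π * τ⁻¹) := by
  funext x
  by_cases h : ∃ m, e m = x
  · obtain ⟨m, rfl⟩ := h
    rw [label_apply he, show e m = (e ∘ τ) (τ⁻¹ m) by simp, label_apply (he.comp τ.injective)]
    rfl
  · push Not at h
    rw [label_of_notMem _ h, label_of_notMem (e := e ∘ τ) _ fun m => h (τ m)]

theorem altSum_comp (he : Function.Injective e) (τ : Equiv.Perm (Fin k)) :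
    altSum K (e ∘ τ) = ((Equiv.Perm.sign τ : ℤ) : K) • altSum K e := by
  rw [altSum, altSum, Finset.smul_sum]
  refine Fintype.sum_equiv (Equiv.mulRight τ⁻¹) _ _ fun π => ?_
  rw [label_comp he, Equiv.coe_mulRight, smul_smul]
  congr 1
  rw [Equiv.Perm.sign_mul, Equiv.Perm.sign_inv]
  rcases Int.units_eq_one_or (Equiv.Perm.sign τ) with h | h <;> simp [h]

theorem label_proper {W : Finset V} (he : Function.Injective e) (hW : ∀ m, e m ∈ W)
    (π : Equiv.Perm (Fin k)) : Proper W k (label e π) := by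
  refine ⟨fun x hx => label_of_notMem π fun m hm => hx (hm ▸ hW m), fun x => ?_,
    fun j hj hjk => ⟨e (π⁻¹ ⟨j - 1, by omega⟩), ?_⟩⟩
  · by_cases h : ∃ m, e m = x
    · obtain ⟨m, rfl⟩ := h
      rw [label_apply he]
      omega
    · push Not at h
      simp [label_of_notMem π h]
  · rw [label_apply he]
    simp
    omega

theorem altSum_mem {W : Finset V} (he : Function.Injective e) (hW : ∀ m, e m ∈ W) :
    altSum K e ∈ properChains K W k :=
  Submodule.sum_mem _ fun π _ => Submodule.smul_mem _ _
    (single_mem_properChains (label_proper he hW π))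

end

/-- Extend a permutation to one more letter, which goes to `p.1` while the others keep their
relative order. -/
def insertPerm {k : ℕ} (p : Fin (k + 1) × Equiv.Perm (Fin k)) : Equiv.Perm (Fin (k + 1)) :=
  p.1.cycleRange⁻¹ * Equiv.Perm.decomposeFin.symm (0, p.2)

theorem insertPerm_zero {k : ℕ} (p : Fin (k + 1) × Equiv.Perm (Fin k)) : insertPerm p 0 = p.1 := by
  simp [insertPerm, Equiv.Perm.inv_def, Fin.cycleRange_symm_zero]

theorem insertPerm_succ {k : ℕ} (p : Fin (k + 1) × Equiv.Perm (Fin k)) (m : Fin k) :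
    insertPerm p m.succ = p.1.succAbove (p.2 m) := by
  simp [insertPerm, Equiv.Perm.inv_def, Fin.cycleRange_symm_succ]

theorem sign_insertPerm {k : ℕ} (p : Fin (k + 1) × Equiv.Perm (Fin k)) :
    Equiv.Perm.sign (insertPerm p) = (-1) ^ (p.1 : ℕ) * Equiv.Perm.sign p.2 := by
  rw [insertPerm, Equiv.Perm.sign_mul, Equiv.Perm.sign_inv, Fin.sign_cycleRange,
    Equiv.Perm.decomposeFin.symm_sign]
  simp

theorem insertPerm_bijective (k : ℕ) : Function.Bijective (insertPerm (k := k)) := by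
  rw [Fintype.bijective_iff_injective_and_card]
  refine ⟨fun p q h => ?_, ?_⟩
  · have h1 : p.1 = q.1 := by rw [← insertPerm_zero p, h, insertPerm_zero]
    refine Prod.ext h1 (Equiv.ext fun m => ?_)
    have h2 : insertPerm p m.succ = insertPerm q m.succ := by rw [h]
    rw [insertPerm_succ, insertPerm_succ, h1] at h2
    exact Fin.succAbove_right_injective h2
  · simp [Fintype.card_perm, Nat.factorial_succ]

theorem ins_label {k : ℕ} {e : Fin k → V} (he : Function.Injective e) {v : V} (hv : ∀ m, e m ≠ v)
    (p : Fin (k + 1) × Equiv.Perm (Fin k)) :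
    ins v p.1 (label e p.2) = label (Fin.cons v e : Fin (k + 1) → V) (insertPerm p) := by
  have hc : Function.Injective (Fin.cons v e : Fin (k + 1) → V) :=
    Fin.cons_injective_iff.2 ⟨fun ⟨m, hm⟩ => hv m hm, he⟩
  funext x
  by_cases hx : x = v
  · subst hx
    have := label_apply hc (insertPerm p) 0
    rw [Fin.cons_zero, insertPerm_zero] at this
    rw [this]
    simp [ins]
  · by_cases h : ∃ m, e m = x
    · obtain ⟨m, rfl⟩ := h
      have := label_apply hc (insertPerm p) m.succ
      rw [Fin.cons_succ, insertPerm_succ] at this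
      rw [this]
      simp only [ins, hx, if_false, label_apply he, Fin.succAbove, Fin.lt_def, Fin.val_castSucc]
      split_ifs <;> simp <;> omega
    · push Not at h
      rw [label_of_notMem]
      · simp [ins, hx, label_of_notMem _ h]
      · intro m
        refine Fin.cases ?_ (fun m => ?_) m
        · simpa using Ne.symm hx
        · simpa using h m

/-- A permutation of k + 1 letters is a position `i` for the new letter together with a permutation
of the rest; its sign picks up (-1)^i, the sign of the insertion. -/
theorem insSum_altSum {k : ℕ} {e : Fin k → V} (he : Function.Injective e) {v : V}
    (hv : ∀ m, e m ≠ v) :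
    insSum K v k (altSum K e) = altSum K (Fin.cons v e : Fin (k + 1) → V) := by
  rw [altSum, altSum, map_sum, ← Fintype.sum_bijective _ (insertPerm_bijective k) (fun p =>
    ((Equiv.Perm.sign (insertPerm p) : ℤ) : K) •
      Finsupp.single (label (Fin.cons v e : Fin (k + 1) → V) (insertPerm p)) 1) _ fun _ => rfl,
    Fintype.sum_prod_type_right]
  refine Finset.sum_congr rfl fun π _ => ?_
  rw [map_smul, insSum_single, Finset.sum_range, Finset.smul_sum]
  refine Finset.sum_congr rfl fun i _ => ?_
  rw [sign_insertPerm, ← ins_label he hv (i, π), smul_smul]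
  congr 1
  push_cast
  ring

/-- An alternating sum is an iterated shuffle of single vertices, and the boundary passes through
shuffles up to sign. -/
theorem faceSum_altSum : ∀ {k : ℕ} {e : Fin (k + 1) → V}, Function.Injective e →
    faceSum K k (altSum K e) = 0 := by
  intro k
  induction k with
  | zero =>
    intro e he
    have h : Function.Injective (Fin.tail e) := he.comp (Fin.succ_injective _)
    rw [← Fin.cons_self_tail e, ← insSum_altSum K h fun m hm => by
      exact absurd (he hm) (Fin.succ_ne_zero m)]
    exact faceSum_insSum_degree_zero (e 0) (altSum_mem K (W := Finset.univ.image (Fin.tail e)) h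
      fun m => Finset.mem_image_of_mem _ (Finset.mem_univ m))
  | succ k ih =>
    intro e he
    have h : Function.Injective (Fin.tail e) := he.comp (Fin.succ_injective _)
    rw [← Fin.cons_self_tail e, ← insSum_altSum K h fun m hm => by
      exact absurd (he hm) (Fin.succ_ne_zero m),
      faceSum_insSum (e 0) (altSum_mem K (W := Finset.univ.image (Fin.tail e)) h
      fun m => Finset.mem_image_of_mem _ (Finset.mem_univ m)), ih h, map_zero, neg_zero]

/-- The span of the alternating sums over injective labellings of vertices of `W`. -/
def altSpan (W : Finset V) (k : ℕ) : Submodule K ((V → ℕ) →₀ K) :=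
  Submodule.span K {c | ∃ e : Fin k → V, Function.Injective e ∧ (∀ m, e m ∈ W) ∧ c = altSum K e}

variable {K}

theorem insSum_mem_altSpan {W : Finset V} {v : V} (hv : v ∉ W) {k : ℕ} {c : (V → ℕ) →₀ K}
    (hc : c ∈ altSpan K W k) : insSum K v k c ∈ altSpan K (insert v W) (k + 1) := by
  have : altSpan K W k ≤ (altSpan K (insert v W) (k + 1)).comap (insSum K v k) := by
    rw [altSpan, Submodule.span_le]
    rintro _ ⟨e, he, hW, rfl⟩
    have hne : ∀ m, e m ≠ v := fun m hm => hv (hm ▸ hW m)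
    refine Submodule.subset_span ⟨Fin.cons v e,
      Fin.cons_injective_iff.2 ⟨fun ⟨m, hm⟩ => hne m hm, he⟩, fun m => ?_, insSum_altSum K he hne⟩
    refine Fin.cases ?_ (fun m => ?_) m
    · simp
    · simp [hW m]
  exact this hc

theorem altSpan_mono {W W' : Finset V} (h : W ⊆ W') (k : ℕ) : altSpan K W k ≤ altSpan K W' k :=
  Submodule.span_mono fun _ ⟨e, he, hW, hc⟩ => ⟨e, he, fun m => h (hW m), hc⟩

/-- Every cycle of the complex of proper chains is homologous to a combination of alternating
sums. -/
theorem cycle_mem_sup (o : V) (W : Finset V) (ho : o ∉ W) :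
    ∀ (k : ℕ) (c : (V → ℕ) →₀ K), c ∈ properChains K W k → c ∈ cycles (C := fun _ => (V → ℕ) →₀ K) (faceSum K) k →
      c ∈ (properChains K W (k + 1)).map (faceSum K k) ⊔ altSpan K W k := by
  have zero : ∀ (W : Finset V) (c : (V → ℕ) →₀ K), c ∈ properChains K W 0 →
      c ∈ altSpan K W 0 := fun W c hc => by
    refine properChains_induction (fun f hf => ?_) hc
    refine Submodule.subset_span ⟨Fin.elim0, fun m => m.elim0, fun m => m.elim0, ?_⟩
    rw [altSum, Fintype.sum_unique]
    simp only [Equiv.Perm.default_eq, Equiv.Perm.sign_one, Units.val_one, Int.cast_one, one_smul]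
    congr 1
    funext x
    rw [label_of_notMem _ fun m => m.elim0]
    exact Nat.le_zero.1 (hf.2.1 x)
  induction W using Finset.induction_on with
  | empty =>
    rintro (_ | k) c hc -
    · exact Submodule.mem_sup_right (zero _ _ hc)
    · have : c = 0 := properChains_induction (p := ⊥) (fun f hf => by
        obtain ⟨x, hx⟩ := hf.2.2 1 (by omega) (by omega)
        rw [hf.1 x (Finset.notMem_empty x)] at hx
        omega) hc
      rw [this]
      exact Submodule.zero_mem _
  | insert v W hv ih =>
    rintro (_ | k) c hc hcyc
    · exact Submodule.mem_sup_right (zero _ _ hc)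
    have hoW : o ∉ W := fun h => ho (Finset.mem_insert_of_mem h)
    have hDc : faceSum K k c = 0 := hcyc
    obtain ⟨a, ha, b, hb, hab⟩ := moveBack_homotopy ho hc
    rw [hDc, map_zero, sub_zero] at hab
    have hmb := moveBack_mem hv hc
    -- The boundary of a + shuffle(b) is zero and has the same shape: ∂a minus the shuffle of ∂b.
    -- Independence of the two summands makes each vanish.
    obtain ⟨hac, hbc⟩ : a ∈ cycles (C := fun _ => (V → ℕ) →₀ K) (faceSum K) (k + 1) ∧ b ∈ cycles (C := fun _ => (V → ℕ) →₀ K) (faceSum K) k := by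
      have hDD : faceSum K k (faceSum K (k + 1) (moveBack K v c)) = 0 :=
        faceSum_faceSum hmb
      have hD := congrArg (faceSum K k) hab
      rw [map_sub, hDc, hDD, sub_zero, map_add] at hD
      cases k with
      | zero =>
        rw [faceSum_insSum_degree_zero v hb, add_zero] at hD
        exact ⟨hD.symm, Submodule.mem_top⟩
      | succ k =>
        rw [faceSum_insSum v hb, ← map_neg] at hD
        obtain ⟨h1, h2⟩ := eq_zero_of_add_insSum_eq_zero hv (faceSum_mem ha)
          (Submodule.neg_mem _ (faceSum_mem hb)) hD.symm
        exact ⟨h1, neg_eq_zero.1 h2⟩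
    -- Shuffling `v` into the decomposition of `b` carries boundaries to boundaries and alternating
    -- sums to alternating sums.
    have hb' : insSum K v k b ∈ (properChains K (insert v W) (k + 1 + 1)).map (faceSum K (k + 1)) ⊔
        altSpan K (insert v W) (k + 1) := by
      obtain ⟨_, ⟨x, hx, rfl⟩, y, hy, rfl⟩ := Submodule.mem_sup.1 (ih hoW k b hb hbc)
      rw [map_add, ← neg_neg (insSum K v k (faceSum K k x)), ← faceSum_insSum v hx]
      exact Submodule.add_mem_sup (Submodule.neg_mem _ ⟨_, insSum_mem hv hx, rfl⟩)
        (insSum_mem_altSpan hv hy)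
    have ha' : a ∈ (properChains K (insert v W) (k + 1 + 1)).map (faceSum K (k + 1)) ⊔
        altSpan K (insert v W) (k + 1) :=
      SetLike.le_def.1 (sup_le_sup (Submodule.map_mono (properChains_mono
        (Finset.subset_insert v W) _)) (altSpan_mono (Finset.subset_insert v W) _))
        (ih hoW (k + 1) a ha hac)
    rw [show c = faceSum K (k + 1) (moveBack K v c) + (a + insSum K v k b) by rw [← hab]; abel]
    exact Submodule.add_mem _ (Submodule.mem_sup_left ⟨_, hmb, rfl⟩) (Submodule.add_mem _ ha' hb')

end Shuffle

/-! ### Functionals dual to the representatives -/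

theorem mem_span_of_dual {K M ι : Type*} [Field K] [AddCommGroup M] [Module K M] {z : ι → M}
    {ψ : ι → M →ₗ[K] K} (h1 : ∀ i, ψ i (z i) = 1) (h0 : ∀ i j, i ≠ j → ψ i (z j) = 0)
    {P : ι → Prop} {y : M} (hy : y ∈ Submodule.span K (Set.range z))
    (hψ : ∀ i, ¬ P i → ψ i y = 0) :
    y ∈ Submodule.span K (Set.range fun i : {i // P i} => z i) := by
  obtain ⟨c, rfl⟩ := Finsupp.mem_span_range_iff_exists_finsupp.1 hy
  refine Submodule.sum_mem _ fun i hi => Submodule.smul_mem _ _ ?_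
  by_cases hP : P i
  · exact Submodule.subset_span ⟨⟨i, hP⟩, rfl⟩
  · have h := hψ i hP
    rw [map_finsuppSum, Finsupp.sum, Finset.sum_eq_single i (fun j _ hj => by
      rw [map_smul, h0 i j hj.symm, smul_zero]) (fun h => absurd hi h), map_smul, h1,
      smul_eq_mul, mul_one] at h
    exact absurd h (Finsupp.mem_support_iff.1 hi)

section Detect

variable (K : Type*) [Field K] {V : Type*}

/-- The functional that detects the block-index functions sending `e m` to `m + 1`. -/
def detect {k : ℕ} (e : Fin k → V) : ((V → ℕ) →₀ K) →ₗ[K] K :=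
  Finsupp.linearCombination K fun f => if ∀ m, f (e m) = m + 1 then 1 else 0

theorem detect_single {k : ℕ} (e : Fin k → V) (f : V → ℕ) :
    detect K e (Finsupp.single f 1) = if ∀ m, f (e m) = m + 1 then 1 else 0 := by
  simp [detect]

theorem detect_faceSum {k : ℕ} (e : Fin k → V) (c : (V → ℕ) →₀ K) :
    detect K e (faceSum K k c) = 0 := by
  suffices detect K e ∘ₗ faceSum K k = 0 from LinearMap.congr_fun this c
  refine Finsupp.lhom_ext' fun f => LinearMap.ext_ring ?_
  simp only [LinearMap.comp_apply, Finsupp.lsingle_apply, LinearMap.zero_apply, faceSum_single,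
    map_sum, map_smul, detect_single, smul_eq_mul, Function.comp]
  -- `a i` tests whether the vertices of `e` occupy, in order, the indices 1, …, k + 1 with i + 1
  -- left out. Face i succeeds exactly when the vertex landing in block i came from block i or from
  -- block i + 1, which gives `a i + a (i - 1)`; the extreme faces i = 0 and i = k + 1 give one term
  -- each. The alternating sum then telescopes to zero.
  let a : ℕ → K := fun i => if ∀ m : Fin k, f (e m) = if m < i then (m : ℕ) + 1 else m + 2
    then 1 else 0
  have ha : ∀ i, (if ∀ m : Fin k, face k i (f (e m)) = m + 1 then (1 : K) else 0) =
      (if i ≤ k then a i else 0) + (if 1 ≤ i then a (i - 1) else 0) := by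
    intro i
    rcases Nat.eq_zero_or_pos i with rfl | hi
    · simp only [Nat.zero_le, if_true, a, show ¬ 1 ≤ 0 by omega, if_false, add_zero]
      refine if_congr (forall_congr' fun m => ?_) rfl rfl
      simp only [face]
      split_ifs <;> omega
    rw [if_pos (show 1 ≤ i from hi)]
    by_cases hik : i ≤ k
    swap
    · rw [if_neg hik, zero_add]
      refine if_congr (forall_congr' fun m => ?_) rfl rfl
      simp only [face]
      split_ifs <;> try simp only [false_iff]
      all_goals omega
    rw [if_pos hik]
    have hm : i - 1 < k := by omega
    by_cases h1 : f (e ⟨i - 1, hm⟩) = i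
    · have h2 : a (i - 1) = 0 := if_neg fun h => by
        have := h ⟨i - 1, hm⟩
        simp only [h1, lt_irrefl, if_false] at this
        omega
      rw [h2, add_zero]
      refine if_congr (forall_congr' fun m => ?_) rfl rfl
      by_cases hmi : m = ⟨i - 1, hm⟩
      · subst hmi
        simp only [h1, face]
        split_ifs <;> omega
      · have : m.val ≠ i - 1 := fun h => hmi (Fin.ext h)
        simp only [face]
        split_ifs <;> omega
    · have h2 : a i = 0 := if_neg fun h => h1 (by
        have := h ⟨i - 1, hm⟩
        simp only [show i - 1 < i by omega, if_true] at this
        omega)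
      rw [h2, zero_add]
      refine if_congr (forall_congr' fun m => ?_) rfl rfl
      by_cases hmi : m = ⟨i - 1, hm⟩
      · subst hmi
        simp only [face]
        split_ifs <;> omega
      · have : m.val ≠ i - 1 := fun h => hmi (Fin.ext h)
        simp only [face]
        split_ifs <;> omega
  simp only [ha, mul_add, Finset.sum_add_distrib]
  rw [Finset.sum_range_succ, Finset.sum_range_succ' (n := k + 1)]
  simp only [if_neg (show ¬ k + 1 ≤ k by omega), mul_zero, add_zero,
    if_neg (show ¬ 1 ≤ 0 by omega), ← Finset.sum_add_distrib]
  refine Finset.sum_eq_zero fun i hi => ?_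
  have := Finset.mem_range.1 hi
  rw [if_pos (by omega), if_pos (by omega), Nat.add_sub_cancel, pow_succ]
  ring

end Detect

/-! ### Rotating the block of `o` to the front -/

section Normalize

variable (K : Type*) [Field K] {n : ℕ} {H : Hypergraph n} (o : Fin n)

/-- Block indices counted cyclically from the block of `o`. -/
def normIdx {k : ℕ} (f : OrdPart H (k + 1)) (x : Fin n) : ℕ :=
  if (f.1 o).val ≤ (f.1 x).val then (f.1 x).val - (f.1 o).val
    else (f.1 x).val + (k + 1) - (f.1 o).val

theorem normIdx_rot {k : ℕ} (f : OrdPart H (k + 1)) : normIdx o (rot f) = normIdx o f := by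
  funext x
  have h1 := (f.1 x).isLt
  have h2 := (f.1 o).isLt
  simp only [normIdx, rot, OrdPart.map, Function.comp, rotIdx]
  split_ifs <;> omega

theorem normIdx_of_zero {k : ℕ} {f : OrdPart H (k + 1)} (hf : f.1 o = 0) :
    normIdx o f = fun x => (f.1 x).val := by
  funext x
  simp [normIdx, hf]

theorem normIdx_proper {k : ℕ} (f : OrdPart H (k + 1)) :
    Proper (Finset.univ.erase o) k (normIdx o f) := by
  have h2 := (f.1 o).isLt
  refine ⟨fun x hx => ?_, fun x => ?_, fun j hj hjk => ?_⟩
  · have : x = o := by simpa using hx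
    simp [normIdx, this]
  · have h1 := (f.1 x).isLt
    simp only [normIdx]
    split_ifs <;> omega
  · by_cases h : (f.1 o).val + j ≤ k
    · obtain ⟨x, hx⟩ := f.2.1 ⟨(f.1 o).val + j, by omega⟩
      refine ⟨x, ?_⟩
      simp only [normIdx, hx]
      split_ifs <;> omega
    · obtain ⟨x, hx⟩ := f.2.1 ⟨(f.1 o).val + j - (k + 1), by omega⟩
      refine ⟨x, ?_⟩
      simp only [normIdx, hx]
      split_ifs <;> omega

/-- Rotate the block of `o` to the front. -/
def normalize (k : ℕ) : Chain K H k →ₗ[K] ((Fin n → ℕ) →₀ K) :=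
  (cyclicRel K H k).liftQ (Finsupp.linearCombination K fun f =>
    (-1 : K) ^ (k * (f.1 o).val) • Finsupp.single (normIdx o f) 1) (by
    rw [cyclicRel, Submodule.span_le]
    rintro _ ⟨f, rfl⟩
    rw [SetLike.mem_coe, LinearMap.mem_ker, map_sub, map_smul, Finsupp.linearCombination_single,
      Finsupp.linearCombination_single, normIdx_rot, one_smul, one_smul, smul_smul, ← sub_smul]
    convert zero_smul K _
    -- A rotation lowers the index of `o` by one, which changes the sign by (-1)^k; when the index
    -- wraps from 0 to k the total exponent is k + k², an even number.
    rw [sub_eq_zero, ← pow_add]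
    have h : ((rot f).1 o).val = if (f.1 o).val = 0 then k else (f.1 o).val - 1 := rfl
    rw [h]
    split_ifs with h0
    · rw [h0, mul_zero, pow_zero, show k + k * k = k * (k + 1) by ring,
        (Nat.even_mul_succ_self k).neg_one_pow]
    · obtain ⟨m, hm⟩ := Nat.exists_eq_succ_of_ne_zero h0
      rw [hm, Nat.succ_eq_add_one, Nat.add_sub_cancel]
      congr 1
      ring)

theorem normalize_cls {k : ℕ} (f : OrdPart H (k + 1)) :
    normalize K o k (cls K f) =
      (-1 : K) ^ (k * (f.1 o).val) • Finsupp.single (normIdx o f) 1 := by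
  change (cyclicRel K H k).liftQ _ _ ((cyclicRel K H k).mkQ _) = _
  rw [Submodule.mkQ_apply, Submodule.liftQ_apply, Finsupp.linearCombination_single, one_smul]

theorem normalize_cls_of_zero {k : ℕ} {f : OrdPart H (k + 1)} (hf : f.1 o = 0) :
    normalize K o k (cls K f) = Finsupp.single (fun x => (f.1 x).val) 1 := by
  rw [normalize_cls, normIdx_of_zero o hf, hf]
  simp

variable {K}

theorem chain_induction {k : ℕ} {p : Submodule K (Chain K H k)}
    (h : ∀ f : OrdPart H (k + 1), f.1 o = 0 → cls K f ∈ p) (c : Chain K H k) : c ∈ p := by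
  have key : ∀ (m : ℕ) (f : OrdPart H (k + 1)), (f.1 o).val = m → cls K f ∈ p := by
    intro m
    induction m with
    | zero => exact fun f hf => h f (Fin.ext hf)
    | succ m ih =>
      intro f hf
      have h1 := ih (rot f) (by simp [rot, OrdPart.map, rotIdx, hf])
      rw [cls_rot] at h1
      have := p.smul_mem ((-1 : K) ^ k) h1
      rwa [smul_smul, neg_one_pow_mul_self, one_smul] at this
  obtain ⟨x, rfl⟩ := Submodule.mkQ_surjective (cyclicRel K H k) c
  induction x using Finsupp.induction_linear with
  | zero => rw [map_zero]; exact p.zero_mem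
  | add a b ha hb => rw [map_add]; exact p.add_mem ha hb
  | single f a =>
    rw [← mul_one a, ← smul_eq_mul, ← Finsupp.smul_single, map_smul]
    exact p.smul_mem _ (key _ f rfl)

/-- Once `o` is in block 0, every union leaves it there, the cyclic one included because that union
is placed first. The two boundaries then agree term by term. -/
theorem normalize_boundary {k : ℕ} (c : Chain K H (k + 1)) :
    normalize K o k (boundary K H k c) = faceSum K k (normalize K o (k + 1) c) := by
  refine chain_induction o (p := LinearMap.eqLocus (normalize K o k ∘ₗ boundary K H k)
    (faceSum K k ∘ₗ normalize K o (k + 1))) (fun f hf => ?_) c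
  rw [LinearMap.mem_eqLocus, LinearMap.comp_apply, LinearMap.comp_apply, boundary_cls,
    normalize_cls_of_zero K o hf, faceSum_single, Finset.sum_range]
  simp only [map_sum, map_smul]
  refine Finset.sum_congr rfl fun i _ => ?_
  rw [normalize_cls_of_zero]
  · rfl
  · simp only [merge, OrdPart.map, Function.comp, hf]
    simp [mergeIdx]

theorem normalize_mem {k : ℕ} (c : Chain K H k) :
    normalize K o k c ∈ properChains K (Finset.univ.erase o) k := by
  refine chain_induction o (p := (properChains K (Finset.univ.erase o) k).comap
    (normalize K o k)) (fun f _ => ?_) c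
  rw [Submodule.mem_comap, normalize_cls]
  exact Submodule.smul_mem _ _ (single_mem_properChains (normIdx_proper o f))

variable {o}

/-- The ordered partition of `E_n` given by a proper block-index function. -/
def Proper.ordPart {k : ℕ} {f : Fin n → ℕ} (hf : Proper (Finset.univ.erase o) k f) :
    OrdPart (completeLooped n) (k + 1) :=
  ⟨fun x => ⟨f x, Nat.lt_succ_of_le (hf.2.1 x)⟩, by
    constructor
    · intro j
      rcases Nat.eq_zero_or_pos j.val with h | h
      · exact ⟨o, Fin.ext (by simp [hf.1 o (by simp), h])⟩
      · obtain ⟨x, hx⟩ := hf.2.2 j h (Nat.lt_succ_iff.1 j.isLt)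
        exact ⟨x, Fin.ext hx⟩
    · exact ⟨{o}, Or.inl (Finset.card_singleton o), _, fun v hv => by
        rw [Finset.mem_singleton.1 hv]⟩⟩

theorem Proper.ordPart_zero {k : ℕ} {f : Fin n → ℕ} (hf : Proper (Finset.univ.erase o) k f) :
    hf.ordPart.1 o = 0 :=
  Fin.ext (hf.1 o (by simp))

theorem normalize_ordPart {k : ℕ} {f : Fin n → ℕ} (hf : Proper (Finset.univ.erase o) k f) :
    normalize K o k (cls K hf.ordPart) = Finsupp.single f 1 := by
  rw [normalize_cls_of_zero K o hf.ordPart_zero]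
  rfl

variable (K o) in
theorem normalize_injective (k : ℕ) :
    Function.Injective (normalize (H := completeLooped n) K o k) := by
  classical
  let r : ((Fin n → ℕ) →₀ K) →ₗ[K] Chain K (completeLooped n) k :=
    Finsupp.linearCombination K fun f =>
      if h : Proper (Finset.univ.erase o) k f then cls K h.ordPart else 0
  refine Function.LeftInverse.injective (g := r) fun c => ?_
  refine chain_induction o (p := LinearMap.eqLocus (r ∘ₗ normalize K o k) LinearMap.id)
    (fun f hf => ?_) c
  have hp : Proper (Finset.univ.erase o) k (fun x => (f.1 x).val) :=
    normIdx_of_zero o hf ▸ normIdx_proper o f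
  rw [LinearMap.mem_eqLocus, LinearMap.comp_apply, normalize_cls_of_zero K o hf]
  simp only [r, Finsupp.linearCombination_single, one_smul, dif_pos hp]
  rfl

theorem exists_normalize_eq {k : ℕ} {c : (Fin n → ℕ) →₀ K}
    (hc : c ∈ properChains K (Finset.univ.erase o) k) :
    ∃ x : Chain K (completeLooped n) k, normalize K o k x = c :=
  properChains_induction (p := LinearMap.range (normalize (H := completeLooped n) K o k))
    (fun _ hf => ⟨_, normalize_ordPart hf⟩) hc

theorem normalize_mem_cycles {k : ℕ} {c : Chain K (completeLooped n) k} :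
    normalize K o k c ∈ cycles (C := fun _ => (Fin n → ℕ) →₀ K) (faceSum K) k ↔
      c ∈ cycles (boundary K (completeLooped n)) k := by
  cases k with
  | zero => simp [cycles]
  | succ k =>
    simp only [cycles, LinearMap.mem_ker]
    rw [← normalize_boundary, map_eq_zero_iff _ (normalize_injective K o k)]

end Normalize

/-! ### The representatives and the homology of the unreduced complex -/

section Representatives

variable {K : Type*} [Field K] {n : ℕ} {o : Fin n} {k : ℕ}

/-- The increasing enumeration of the vertices outside `A ∪ {o}`. -/
def RepIndex.enum (A : RepIndex o k) (m : Fin k) : Fin n := A.rest.orderIsoOfFin A.card_rest m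

theorem RepIndex.enum_injective (A : RepIndex o k) : Function.Injective A.enum :=
  Subtype.val_injective.comp (A.rest.orderIsoOfFin A.card_rest).injective

theorem RepIndex.enum_mem (A : RepIndex o k) (m : Fin k) : A.enum m ∈ A.rest :=
  (A.rest.orderIsoOfFin A.card_rest m).2

theorem RepIndex.enum_ne_of_notMem (A : RepIndex o k) {x : Fin n} (hx : x ∉ A.rest) (m : Fin k) :
    A.enum m ≠ x :=
  fun h => hx (h ▸ A.enum_mem m)

theorem RepIndex.exists_enum_eq (A : RepIndex o k) {x : Fin n} (hx : x ∈ A.rest) :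
    ∃ m, A.enum m = x :=
  ⟨(A.rest.orderIsoOfFin A.card_rest).symm ⟨x, hx⟩, by simp [enum]⟩

theorem RepIndex.mem_rest {A : RepIndex o k} {x : Fin n} : x ∈ A.rest ↔ x ≠ o ∧ x ∉ A.1 := by
  simp [rest]

theorem RepIndex.rest_injective : Function.Injective (rest : RepIndex o k → Finset (Fin n)) := by
  intro A B h
  refine Subtype.ext (Finset.ext fun x => ?_)
  by_cases hx : x = o
  · simp [hx, A.2.1, B.2.1]
  · have := Finset.ext_iff.1 h x
    simp only [mem_rest, hx, ne_eq, not_false_eq_true, true_and] at this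
    exact not_iff_not.1 this

theorem RepIndex.enum_mem_erase (A : RepIndex o k) (m : Fin k) :
    A.enum m ∈ Finset.univ.erase o := by
  simpa using (mem_rest.1 (A.enum_mem m)).1

theorem normalize_repChain (A : RepIndex o k) :
    normalize K o k (repChain K A) = altSum K A.enum := by
  rw [repChain, map_sum, altSum]
  -- Block i + 1 holds `a_{σ(i)}`, so the vertex `a_m` carries the label of `σ⁻¹`; the sign is
  -- unaffected.
  refine Fintype.sum_equiv (Equiv.inv _) _ _ fun σ => ?_
  rw [map_smul, Equiv.inv_apply, Equiv.Perm.sign_inv, normalize_cls_of_zero]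
  · congr 2
    funext x
    by_cases hx : x ∈ A.rest
    · obtain ⟨m, rfl⟩ := A.exists_enum_eq hx
      rw [label_apply A.enum_injective]
      simp only [RepIndex.part, hx, dif_pos, Fin.val_succ]
      simp only [RepIndex.enum, Subtype.coe_eta, OrderIso.symm_apply_apply, Equiv.Perm.inv_def]
    · rw [label_of_notMem (e := A.enum) _ (A.enum_ne_of_notMem hx)]
      simp [RepIndex.part, hx]
  · have : o ∉ A.rest := by simp [RepIndex.rest]
    simp [RepIndex.part, this]

theorem detect_enum_self (A : RepIndex o k) : detect K A.enum (altSum K A.enum) = 1 := by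
  rw [altSum, map_sum, Finset.sum_eq_single 1]
  · simp [detect_single, label_apply A.enum_injective]
  · intro π _ hπ
    rw [map_smul, detect_single, if_neg, smul_zero]
    intro h
    refine hπ (Equiv.ext fun m => Fin.ext ?_)
    have := h m
    rw [label_apply A.enum_injective] at this
    simpa using this
  · simp

theorem detect_enum_of_ne {A B : RepIndex o k} (h : A ≠ B) :
    detect K A.enum (altSum K B.enum) = 0 := by
  rw [altSum, map_sum]
  refine Finset.sum_eq_zero fun π _ => ?_
  rw [map_smul, detect_single, if_neg, smul_zero]
  intro hπ
  refine h (RepIndex.rest_injective (Finset.eq_of_subset_of_card_le (fun x hx => ?_)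
    (by rw [A.card_rest, B.card_rest])))
  obtain ⟨m, rfl⟩ := A.exists_enum_eq hx
  by_contra hB
  have := hπ m
  rw [label_of_notMem (e := B.enum) _ (B.enum_ne_of_notMem hB)] at this
  exact absurd this (Nat.succ_ne_zero _).symm

/-- Take A to be what `o` and the image of `e` leave over. Through `altSum_comp`, this reduces
arbitrary alternating sums to the increasing ones, up to sign. -/
theorem exists_enum_comp {e : Fin k → Fin n} (he : Function.Injective e) (ho : ∀ m, e m ≠ o) :
    ∃ (A : RepIndex o k) (τ : Equiv.Perm (Fin k)), e = A.enum ∘ τ := by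
  have hc : (Finset.univ.image e).card = k := by
    rw [Finset.card_image_of_injective _ he, Finset.card_univ, Fintype.card_fin]
  have hoi : o ∉ Finset.univ.image e := by simpa using ho
  let A : RepIndex o k := ⟨(insert o (Finset.univ.image e))ᶜ, by simp, by
    have h := Finset.card_add_card_compl (insert o (Finset.univ.image e))
    rw [Finset.card_insert_of_notMem hoi, hc, Fintype.card_fin] at h
    omega⟩
  have hA : ∀ m, e m ∈ A.rest := fun m => by
    rw [RepIndex.mem_rest]
    exact ⟨ho m, by simp [A]⟩
  choose τ hτ using fun m => A.exists_enum_eq (hA m)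
  have hi : Function.Injective τ := fun a b h => he (by rw [← hτ a, h, hτ b])
  exact ⟨A, Equiv.ofBijective τ (Finite.injective_iff_bijective.1 hi),
    funext fun m => (hτ m).symm⟩

theorem altSpan_le :
    altSpan K (Finset.univ.erase o) k ≤
      Submodule.span K (Set.range fun A : RepIndex o k => altSum K A.enum) := by
  rw [altSpan, Submodule.span_le]
  rintro _ ⟨e, he, hW, rfl⟩
  obtain ⟨A, τ, rfl⟩ := exists_enum_comp he fun m => by simpa using hW m
  rw [altSum_comp K A.enum_injective]
  exact Submodule.smul_mem _ _ (Submodule.subset_span ⟨A, rfl⟩)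

/-- The functionals dual to the representatives. -/
def repDual (K : Type*) [Field K] (A : RepIndex o k) : Chain K (completeLooped n) k →ₗ[K] K :=
  detect K A.enum ∘ₗ normalize K o k

theorem repDual_boundary (A : RepIndex o k) (c : Chain K (completeLooped n) (k + 1)) :
    repDual K A (boundary K _ k c) = 0 := by
  rw [repDual, LinearMap.comp_apply, normalize_boundary, detect_faceSum]

theorem repDual_self (A : RepIndex o k) : repDual K A (repChain K A) = 1 := by
  rw [repDual, LinearMap.comp_apply, normalize_repChain, detect_enum_self]

theorem repDual_of_ne (A B : RepIndex o k) (h : A ≠ B) : repDual K A (repChain K B) = 0 := by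
  rw [repDual, LinearMap.comp_apply, normalize_repChain, detect_enum_of_ne h]

theorem repChain_mem_cycles (A : RepIndex o k) :
    repChain K A ∈ cycles (boundary K (completeLooped n)) k := by
  rw [← normalize_mem_cycles (o := o), normalize_repChain]
  cases k with
  | zero => exact Submodule.mem_top
  | succ k => exact faceSum_altSum K A.enum_injective

/-- The homology of `Δ(E_n)` is spanned by the classes of the representatives. -/
theorem exists_boundary_add_of_mem_cycles (o : Fin n) {c : Chain K (completeLooped n) k}
    (hc : c ∈ cycles (boundary K (completeLooped n)) k) :
    ∃ x, ∃ y ∈ Submodule.span K (Set.range fun A : RepIndex o k => repChain K A),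
      c = boundary K _ k x + y := by
  obtain ⟨_, ⟨x, hx, rfl⟩, y, hy, h⟩ := Submodule.mem_sup.1 (cycle_mem_sup o (Finset.univ.erase o)
    (by simp) k _ (normalize_mem o c) (normalize_mem_cycles.2 hc))
  obtain ⟨x', rfl⟩ := exists_normalize_eq hx
  have hy' : y ∈ (Submodule.span K (Set.range fun A : RepIndex o k => repChain K A)).map
      (normalize K o k) := by
    rw [Submodule.map_span, ← Set.range_comp]
    have := altSpan_le hy
    simpa only [Function.comp_def, normalize_repChain] using this
  obtain ⟨y', hy', rfl⟩ := hy'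
  exact ⟨x', y', hy', normalize_injective K o k (by rw [map_add, normalize_boundary, h])⟩

end Representatives

/-! ### The subcomplex with `u` and `w` in one block -/

section SameBlock

variable {K : Type*} [Field K] {n : ℕ} {o u w : Fin n} {k : ℕ}

/-- Move `w` to block `0`. -/
def park (K : Type*) [Field K] {n : ℕ} (w : Fin n) :
    ((Fin n → ℕ) →₀ K) →ₗ[K] ((Fin n → ℕ) →₀ K) :=
  Finsupp.linearCombination K fun f => Finsupp.single (Function.update f w 0) 1

/-- Move `w` to the block of `u`. -/
def attach (K : Type*) [Field K] {n : ℕ} (u w : Fin n) :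
    ((Fin n → ℕ) →₀ K) →ₗ[K] ((Fin n → ℕ) →₀ K) :=
  Finsupp.linearCombination K fun f => Finsupp.single (Function.update f w (f u)) 1

theorem park_single (f : Fin n → ℕ) :
    park K w (Finsupp.single f 1) = Finsupp.single (Function.update f w 0) 1 := by
  simp [park]

theorem attach_single (f : Fin n → ℕ) :
    attach K u w (Finsupp.single f 1) = Finsupp.single (Function.update f w (f u)) 1 := by
  simp [attach]

/-- Every face fixes index 0. With `faceSum_attach`, this makes forgetting `w` and restoring it
chain maps between the same-block subcomplex and the complex on one vertex fewer. -/
theorem faceSum_park (c : (Fin n → ℕ) →₀ K) :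
    faceSum K k (park K w c) = park K w (faceSum K k c) := by
  suffices faceSum K k ∘ₗ park K w = park K w ∘ₗ faceSum K k from LinearMap.congr_fun this c
  refine Finsupp.lhom_ext' fun f => LinearMap.ext_ring ?_
  simp only [LinearMap.comp_apply, Finsupp.lsingle_apply, faceSum_single, map_sum, map_smul,
    park_single, Function.comp_update]
  simp [face]

theorem faceSum_attach (c : (Fin n → ℕ) →₀ K) :
    faceSum K k (attach K u w c) = attach K u w (faceSum K k c) := by
  suffices faceSum K k ∘ₗ attach K u w = attach K u w ∘ₗ faceSum K k from
    LinearMap.congr_fun this c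
  refine Finsupp.lhom_ext' fun f => LinearMap.ext_ring ?_
  simp only [LinearMap.comp_apply, Finsupp.lsingle_apply, faceSum_single, map_sum, map_smul,
    attach_single, Function.comp_update, Function.comp_apply]

theorem detect_park {e : Fin k → Fin n} (he : ∀ m, e m ≠ w) (c : (Fin n → ℕ) →₀ K) :
    detect K e (park K w c) = detect K e c := by
  suffices detect K e ∘ₗ park K w = detect K e from LinearMap.congr_fun this c
  refine Finsupp.lhom_ext' fun f => LinearMap.ext_ring ?_
  simp only [LinearMap.comp_apply, Finsupp.lsingle_apply, park_single, detect_single,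
    Function.update_of_ne (he _)]

theorem detect_attach {e : Fin k → Fin n} (he : ∀ m, e m ≠ w) (c : (Fin n → ℕ) →₀ K) :
    detect K e (attach K u w c) = detect K e c := by
  suffices detect K e ∘ₗ attach K u w = detect K e from LinearMap.congr_fun this c
  refine Finsupp.lhom_ext' fun f => LinearMap.ext_ring ?_
  simp only [LinearMap.comp_apply, Finsupp.lsingle_apply, attach_single, detect_single,
    Function.update_of_ne (he _)]

theorem normalize_sameBlock_induction {p : Submodule K ((Fin n → ℕ) →₀ K)}
    (h : ∀ f, Proper (Finset.univ.erase o) k f → f u = f w → Finsupp.single f 1 ∈ p)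
    {c : Chain K (completeLooped n) k} (hc : c ∈ sameBlock K (completeLooped n) u w k) :
    normalize K o k c ∈ p := by
  have : sameBlock K (completeLooped n) u w k ≤ p.comap (normalize K o k) := by
    rw [sameBlock, Submodule.span_le]
    rintro _ ⟨f, hf, rfl⟩
    rw [SetLike.mem_coe, Submodule.mem_comap, normalize_cls]
    exact p.smul_mem _ (h _ (normIdx_proper o f) (by simp [normIdx, hf]))
  exact this hc

/-- Before the move `w` has index 0, so no positive block depends on it. -/
theorem Proper.attach (huw : u ≠ w) {f : Fin n → ℕ} (hw : w ≠ o)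
    (hf : Proper ((Finset.univ.erase o).erase w) k f) :
    Proper (Finset.univ.erase o) k (Function.update f w (f u)) := by
  refine ⟨fun x hx => ?_, fun x => ?_, fun j hj hjk => ?_⟩
  · have : x = o := by simpa using hx
    subst this
    rw [Function.update_of_ne hw.symm]
    exact hf.1 _ (by simp)
  · by_cases hx : x = w
    · simp [hx, hf.2.1 u]
    · rw [Function.update_of_ne hx]
      exact hf.2.1 x
  · obtain ⟨x, hx⟩ := hf.2.2 j hj hjk
    refine ⟨x, ?_⟩
    rw [Function.update_of_ne, hx]
    rintro rfl
    rw [hf.1 x (by simp)] at hx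
    omega

theorem exists_normalize_eq_attach (huw : u ≠ w) (hw : w ≠ o) {c : (Fin n → ℕ) →₀ K}
    (hc : c ∈ properChains K ((Finset.univ.erase o).erase w) k) :
    ∃ s ∈ sameBlock K (completeLooped n) u w k, normalize K o k s = attach K u w c := by
  refine properChains_induction (p := ((sameBlock K (completeLooped n) u w k).map
    (normalize K o k)).comap (attach K u w)) (fun f hf => ?_) hc
  rw [Submodule.mem_comap, attach_single]
  refine ⟨_, Submodule.subset_span ⟨(hf.attach huw hw).ordPart, Fin.ext ?_, rfl⟩,
    normalize_ordPart _⟩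
  simp [Proper.ordPart, Function.update_of_ne huw]

theorem RepIndex.enum_ne {A : RepIndex o k} (hA : w ∈ A.1) (m : Fin k) : A.enum m ≠ w :=
  fun h => (mem_rest.1 (A.enum_mem m)).2 (h ▸ hA)

/-- Apart from `o`, the vertices that a labelling misses make up its set A, so missing `w` means `w
∈ A`. -/
theorem altSpan_erase_le (hw : w ≠ o) :
    altSpan K ((Finset.univ.erase o).erase w) k ≤ Submodule.span K (Set.range
      fun A : {A : RepIndex o k // w ∈ A.1} => altSum K A.1.enum) := by
  rw [altSpan, Submodule.span_le]
  rintro _ ⟨e, he, hW, rfl⟩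
  obtain ⟨A, τ, rfl⟩ := exists_enum_comp (o := o) he fun m hm => by simpa [hm] using hW m
  rw [altSum_comp K A.enum_injective]
  refine Submodule.smul_mem _ _ (Submodule.subset_span ⟨⟨A, ?_⟩, rfl⟩)
  by_contra hwA
  obtain ⟨m, hm⟩ := A.exists_enum_eq (RepIndex.mem_rest.2 ⟨hw, hwA⟩)
  simpa [hm] using hW (τ⁻¹ m)

theorem eq_zero_of_mem_altSpan_erase (hw : w ≠ o) {t : (Fin n → ℕ) →₀ K}
    (ht : t ∈ altSpan K ((Finset.univ.erase o).erase w) k)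
    (hdual : ∀ A : RepIndex o k, w ∈ A.1 → detect K A.enum t = 0) : t = 0 := by
  have := mem_span_of_dual (K := K) (ι := {A : RepIndex o k // w ∈ A.1})
    (z := fun A => altSum K A.1.enum) (ψ := fun A => detect K A.1.enum) (P := fun _ => False)
    (fun A => detect_enum_self A.1)
    (fun A B hAB => detect_enum_of_ne fun h => hAB (Subtype.ext h)) (altSpan_erase_le hw ht)
    fun A _ => hdual A.1 A.2
  rwa [Set.range_eq_empty, Submodule.span_empty, Submodule.mem_bot] at this

/-- A cycle of the same-block subcomplex on which the duals of the representatives of that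
subcomplex vanish is a boundary in that subcomplex. -/
theorem exists_boundary_eq_of_mem_sameBlock (huw : u ≠ w) (hw : w ≠ o)
    {s : Chain K (completeLooped n) k} (hs : s ∈ sameBlock K (completeLooped n) u w k)
    (hcyc : s ∈ cycles (boundary K (completeLooped n)) k)
    (hdual : ∀ B : RepIndex o k, w ∈ B.1 → repDual K B s = 0) :
    ∃ e ∈ sameBlock K (completeLooped n) u w (k + 1), boundary K _ k e = s := by
  have h1 : park K w (normalize K o k s) ∈ properChains K ((Finset.univ.erase o).erase w) k := by
    refine normalize_sameBlock_induction (p := (properChains K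
      ((Finset.univ.erase o).erase w) k).comap (park K w)) (fun f hf hfu => ?_) hs
    rw [Submodule.mem_comap, park_single]
    refine single_mem_properChains (Proper.update_zero ?_ ⟨u, huw, hfu⟩)
    rwa [Finset.insert_erase (by simpa using hw)]
  have h2 : attach K u w (park K w (normalize K o k s)) = normalize K o k s := by
    refine normalize_sameBlock_induction (p := LinearMap.eqLocus (attach K u w ∘ₗ park K w)
      LinearMap.id) (fun f hf hfu => ?_) hs
    rw [LinearMap.mem_eqLocus, LinearMap.comp_apply, park_single, attach_single,
      Function.update_idem, Function.update_of_ne huw, hfu, Function.update_eq_self]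
    rfl
  have h3 : park K w (normalize K o k s) ∈
      cycles (C := fun _ => (Fin n → ℕ) →₀ K) (faceSum K) k := by
    have h := normalize_mem_cycles (o := o).2 hcyc
    cases k with
    | zero => exact Submodule.mem_top
    | succ k =>
      change faceSum K k _ = 0
      rw [faceSum_park, show faceSum K k (normalize K o (k + 1) s) = 0 from h, map_zero]
  obtain ⟨_, ⟨x, hx, rfl⟩, t, ht, h⟩ := Submodule.mem_sup.1 (cycle_mem_sup o
    ((Finset.univ.erase o).erase w) (by simp) k _ h1 h3)
  -- The functionals see neither the boundary part nor the position of `w`, so on `t` they take the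
  -- values they take on `s`, namely zero.
  have ht0 : t = 0 := by
    refine eq_zero_of_mem_altSpan_erase hw ht fun A hA => ?_
    have h' := congrArg (detect K A.enum) h
    rw [map_add, detect_faceSum, zero_add, detect_park (RepIndex.enum_ne hA)] at h'
    rw [h']
    exact hdual A hA
  obtain ⟨e, he, hex⟩ := exists_normalize_eq_attach huw hw hx
  refine ⟨e, he, normalize_injective K o k ?_⟩
  rw [normalize_boundary, hex, faceSum_attach, ← h2, ← h, ht0, add_zero]

end SameBlock

/-! ### Homology of the quotient complex -/

section Quotient

variable {K : Type*} [Field K] {n : ℕ} {o u w : Fin n} {k : ℕ}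

theorem qMk_eq_zero {c : Chain K (completeLooped n) k} :
    QChain.mk K (completeLooped n) u w k c = 0 ↔ c ∈ sameBlock K (completeLooped n) u w k :=
  Submodule.Quotient.mk_eq_zero _

theorem qMk_surjective : Function.Surjective (QChain.mk K (completeLooped n) u w k) :=
  Submodule.mkQ_surjective _

theorem qBoundary_mk (c : Chain K (completeLooped n) (k + 1)) :
    qBoundary K (completeLooped n) u w k (QChain.mk K _ u w (k + 1) c) =
      QChain.mk K _ u w k (boundary K _ k c) :=
  rfl

theorem qMk_mem_cycles {c : Chain K (completeLooped n) k}
    (hc : c ∈ cycles (boundary K (completeLooped n)) k) :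
    QChain.mk K _ u w k c ∈ cycles (qBoundary K (completeLooped n) u w) k := by
  cases k with
  | zero => exact Submodule.mem_top
  | succ k =>
    change qBoundary K _ u w k _ = 0
    rw [qBoundary_mk, show boundary K _ k c = 0 from hc, map_zero]

theorem boundary_mem_cycles (c : Chain K (completeLooped n) (k + 1)) :
    boundary K _ k c ∈ cycles (boundary K (completeLooped n)) k := by
  cases k with
  | zero => exact Submodule.mem_top
  | succ k => exact LinearMap.congr_fun (boundary_boundary K _ k) c

theorem qRepChain_mem_cycles (A : RepIndex o k) :
    qRepChain K u w A ∈ cycles (qBoundary K (completeLooped n) u w) k :=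
  qMk_mem_cycles (repChain_mem_cycles A)

/-- Up to boundaries, the representatives with `w ∈ A` are combinations of the others. -/
theorem qRepChain_mem_sup (huw : u ≠ w) (hw : w ≠ o) (A : RepIndex o k) :
    qRepChain K u w A ∈ LinearMap.range (qBoundary K (completeLooped n) u w k) ⊔
      Submodule.span K (Set.range
        fun B : {B : RepIndex o k // w ∉ B.1} => qRepChain K u w B.1) := by
  by_cases hA : w ∈ A.1
  swap
  · exact Submodule.mem_sup_right (Submodule.subset_span ⟨⟨A, hA⟩, rfl⟩)
  -- Moving `w` from the block of `o` to the block of `u` turns the representative into a cycle `s`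
  -- of the subcomplex, which dies in the quotient.
  obtain ⟨s, hs, hsA⟩ := exists_normalize_eq_attach (K := K) huw hw (k := k)
    (altSum_mem K A.enum_injective fun m => Finset.mem_erase.2
      ⟨RepIndex.enum_ne hA m, A.enum_mem_erase m⟩)
  have hcyc : s ∈ cycles (boundary K (completeLooped n)) k := by
    rw [← normalize_mem_cycles (o := o), hsA]
    cases k with
    | zero => exact Submodule.mem_top
    | succ k =>
      change faceSum K k _ = 0
      rw [faceSum_attach, faceSum_altSum K A.enum_injective, map_zero]
  obtain ⟨x, y, hy, rfl⟩ := exists_boundary_add_of_mem_cycles o hcyc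
  -- The duals of the representatives with `w` in their set ignore where `w` sits, so they agree on
  -- `s` and on the representative of `A`; the difference involves only sets without `w`.
  have hyA : y - repChain K A ∈ Submodule.span K (Set.range
      fun B : {B : RepIndex o k // w ∉ B.1} => repChain K B.1) := by
    refine mem_span_of_dual (ψ := repDual K) repDual_self repDual_of_ne
      (Submodule.sub_mem _ hy (Submodule.subset_span ⟨A, rfl⟩)) fun B hB => ?_
    have h1 : repDual K B (boundary K _ k x + y) = repDual K B (repChain K A) := by
      rw [repDual, LinearMap.comp_apply, hsA, detect_attach (RepIndex.enum_ne (not_not.1 hB)),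
        LinearMap.comp_apply, normalize_repChain]
    rw [map_add, repDual_boundary, zero_add] at h1
    rw [map_sub, h1, sub_self]
  have h0 := qMk_eq_zero.2 hs
  rw [map_add, ← qBoundary_mk] at h0
  have hq : qRepChain K u w A = -qBoundary K _ u w k (QChain.mk K _ u w (k + 1) x) -
      QChain.mk K _ u w k (y - repChain K A) := by
    rw [map_sub, eq_neg_of_add_eq_zero_left h0, qRepChain]
    abel
  rw [hq]
  refine Submodule.sub_mem _ (Submodule.mem_sup_left (Submodule.neg_mem _ ⟨_, rfl⟩))
    (Submodule.mem_sup_right ?_)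
  have := Submodule.mem_map_of_mem (f := QChain.mk K _ u w k) hyA
  rwa [Submodule.map_span, ← Set.range_comp] at this

/-- The connecting map vanishes. The boundary of a lift `c` of a quotient cycle is a cycle of the
subcomplex killed by all duals, hence the boundary of some `e` in the subcomplex, and `c - e` is a
cycle of Δ(E_n) lifting the same element. -/
theorem mem_sup_of_mem_cycles (huw : u ≠ w) (hw : w ≠ o)
    {q : QChain K (completeLooped n) u w k}
    (hq : q ∈ cycles (qBoundary K (completeLooped n) u w) k) :
    q ∈ LinearMap.range (qBoundary K (completeLooped n) u w k) ⊔
      Submodule.span K (Set.range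
        fun B : {B : RepIndex o k // w ∉ B.1} => qRepChain K u w B.1) := by
  obtain ⟨c, rfl⟩ := qMk_surjective q
  obtain ⟨e, he, hce⟩ : ∃ e ∈ sameBlock K (completeLooped n) u w k,
      c - e ∈ cycles (boundary K (completeLooped n)) k := by
    cases k with
    | zero => exact ⟨0, Submodule.zero_mem _, Submodule.mem_top⟩
    | succ k =>
      have hs : boundary K _ k c ∈ sameBlock K (completeLooped n) u w k :=
        qMk_eq_zero.1 ((qBoundary_mk c).symm.trans hq)
      obtain ⟨e, he, h⟩ := exists_boundary_eq_of_mem_sameBlock huw hw hs (boundary_mem_cycles c)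
        fun B _ => repDual_boundary B c
      exact ⟨e, he, by rw [cycles, LinearMap.mem_ker, map_sub, h, sub_self]⟩
  obtain ⟨x, y, hy, h⟩ := exists_boundary_add_of_mem_cycles o hce
  have h1 : QChain.mk K _ u w k c = qBoundary K _ u w k (QChain.mk K _ u w (k + 1) x) +
      QChain.mk K _ u w k y := by
    rw [qBoundary_mk, ← map_add, ← h, map_sub, qMk_eq_zero.2 he, sub_zero]
  rw [h1]
  refine Submodule.add_mem _ (Submodule.mem_sup_left ⟨_, rfl⟩) ?_
  refine Submodule.mem_comap.1 ((Submodule.span_le (p := Submodule.comap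
    (QChain.mk K (completeLooped n) u w k) _)).2 ?_ hy)
  rintro _ ⟨A, rfl⟩
  exact qRepChain_mem_sup huw hw A

theorem homologyClass_surjective {C : ℕ → Type*} [∀ k, AddCommGroup (C k)] [∀ k, Module K (C k)]
    (d : ∀ k, C (k + 1) →ₗ[K] C k) (k : ℕ) : Function.Surjective (homologyClass d k) :=
  Submodule.mkQ_surjective _

theorem homologyClass_eq_zero {C : ℕ → Type*} [∀ k, AddCommGroup (C k)] [∀ k, Module K (C k)]
    {d : ∀ k, C (k + 1) →ₗ[K] C k} {k : ℕ} {z : cycles d k} :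
    homologyClass d k z = 0 ↔ z.1 ∈ LinearMap.range (d k) :=
  Submodule.Quotient.mk_eq_zero _

/-- The homology class of a representative. -/
def repClass (K : Type*) [Field K] (u w : Fin n) (A : RepIndex o k) :
    Homology (qBoundary K (completeLooped n) u w) k :=
  homologyClass _ k ⟨qRepChain K u w A, qRepChain_mem_cycles A⟩

theorem span_repClass (huw : u ≠ w) (hw : w ≠ o) :
    Submodule.span K (Set.range fun A : {A : RepIndex o k // w ∉ A.1} => repClass K u w A.1) =
      ⊤ := by
  rw [eq_top_iff]
  rintro c -
  obtain ⟨⟨q, hq⟩, rfl⟩ := homologyClass_surjective _ k c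
  obtain ⟨x, hx, y, hy, rfl⟩ := Submodule.mem_sup.1 (mem_sup_of_mem_cycles huw hw hq)
  obtain ⟨a, rfl⟩ := Finsupp.mem_span_range_iff_exists_finsupp.1 hy
  have hz := Submodule.sub_mem _ hq ((a.sum fun A r => r • (⟨qRepChain K u w A.1,
    qRepChain_mem_cycles A.1⟩ : cycles (qBoundary K (completeLooped n) u w) k)).2)
  have e : homologyClass (qBoundary K (completeLooped n) u w) k ⟨_, hq⟩ =
      a.sum fun A r => r • repClass K u w A.1 := by
    have : (a.sum fun A r => r • repClass K u w A.1) = homologyClass _ k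
        (a.sum fun A r => r • (⟨qRepChain K u w A.1, qRepChain_mem_cycles A.1⟩ :
          cycles (qBoundary K (completeLooped n) u w) k)) := by
      rw [map_finsuppSum]
      simp only [map_smul]
      rfl
    rw [this, ← sub_eq_zero, ← map_sub, homologyClass_eq_zero]
    convert hx using 1
    simp [Finsupp.sum]
  rw [e]
  exact Submodule.sum_mem _ fun A _ => Submodule.smul_mem _ _ (Submodule.subset_span ⟨A, rfl⟩)

/-- If a combination `y` of representatives bounds in the quotient, then `y - ∂x` lies in the
subcomplex. The duals with `w` in their set vanish on it, so it bounds there; thus `y` bounds in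
Δ(E_n), and the remaining duals read off zero coefficients. -/
theorem linearIndependent_repClass (huw : u ≠ w) (hw : w ≠ o) :
    LinearIndependent K
      (fun A : {A : RepIndex o k // w ∉ A.1} => repClass K u w A.1) := by
  rw [linearIndependent_iff']
  intro t g hg A hA
  have h1 : homologyClass (qBoundary K (completeLooped n) u w) k
      (∑ B ∈ t, g B • ⟨qRepChain K u w B.1, qRepChain_mem_cycles B.1⟩) = 0 := by
    rw [← hg, map_sum]
    simp only [map_smul]
    rfl
  obtain ⟨q, hq⟩ := homologyClass_eq_zero.1 h1
  obtain ⟨x, rfl⟩ := qMk_surjective q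
  set y : Chain K (completeLooped n) k := ∑ B ∈ t, g B • repChain K B.1 with hy
  have hs : y - boundary K _ k x ∈ sameBlock K (completeLooped n) u w k := by
    rw [← qMk_eq_zero, map_sub, ← qBoundary_mk, hq, sub_eq_zero, hy, map_sum]
    simp [qRepChain]
  have hyc : y ∈ cycles (boundary K (completeLooped n)) k :=
    Submodule.sum_mem _ fun B _ => Submodule.smul_mem _ _ (repChain_mem_cycles B.1)
  obtain ⟨e, -, he⟩ := exists_boundary_eq_of_mem_sameBlock huw hw hs
    (Submodule.sub_mem _ hyc (boundary_mem_cycles x)) fun B hB => by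
      rw [map_sub, repDual_boundary, sub_zero, hy, map_sum]
      refine Finset.sum_eq_zero fun A _ => ?_
      rw [map_smul, repDual_of_ne B A.1 fun h => A.2 (h ▸ hB), smul_zero]
  have hyb : y = boundary K _ k (x + e) := by rw [map_add, he]; abel
  have h2 := congrArg (repDual K A.1) hyb
  rw [repDual_boundary, hy, map_sum, Finset.sum_eq_single A (fun B _ hBA => by
    rw [map_smul, repDual_of_ne A.1 B.1 fun h => hBA (Subtype.ext h.symm), smul_zero])
    (fun h => absurd hA h), map_smul, repDual_self, smul_eq_mul, mul_one] at h2
  exact h2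

/-! ### Counting the representatives -/

instance : Finite (RepIndex o k) := Subtype.finite

theorem rank_homology (huw : u ≠ w) (hw : w ≠ o) :
    Module.rank K (Homology (qBoundary K (completeLooped n) u w) k) =
      (Nat.card {A : RepIndex o k // w ∉ A.1} : ℕ) := by
  have := Fintype.ofFinite {A : RepIndex o k // w ∉ A.1}
  rw [rank_eq_card_basis (Module.Basis.mk (linearIndependent_repClass (K := K) huw hw)
    (span_repClass huw hw).ge), Nat.card_eq_fintype_card]

theorem card_repIndex_zero (hw : w ≠ o) : Nat.card {A : RepIndex o 0 // w ∉ A.1} = 0 := by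
  rw [Nat.card_eq_zero]
  refine Or.inl ⟨fun A => A.2 ?_⟩
  by_contra h
  have h1 := A.1.card_rest
  rw [Finset.card_eq_zero] at h1
  have h2 : w ∈ A.1.rest := RepIndex.mem_rest.2 ⟨hw, h⟩
  rw [h1] at h2
  exact absurd h2 (Finset.notMem_empty w)

theorem card_repIndex_succ (hw : w ≠ o) (r : ℕ) :
    Nat.card {A : RepIndex o (r + 1) // w ∉ A.1} = (n - 2).choose r := by
  have hcard : ((Finset.univ.erase o).erase w).card = n - 2 := by
    rw [Finset.card_erase_of_mem (by simpa using hw), Finset.card_erase_of_mem (Finset.mem_univ o),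
      Finset.card_univ, Fintype.card_fin]
    rfl
  by_cases hr : r + 2 ≤ n
  · have e : {A : RepIndex o (r + 1) // w ∉ A.1} ≃
        Finset.powersetCard (n - 2 - r) ((Finset.univ.erase o).erase w) :=
      { toFun := fun A => ⟨A.1.1, by
          have h := A.1.2.2
          rw [Finset.mem_powersetCard]
          refine ⟨fun x hx => ?_, by omega⟩
          simp only [Finset.mem_erase, Finset.mem_univ, and_true]
          exact ⟨fun h => A.2 (h ▸ hx), fun h => A.1.2.1 (h ▸ hx)⟩⟩
        invFun := fun A => ⟨⟨A.1, fun h => by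
            simpa using (Finset.mem_powersetCard.1 A.2).1 h, by
            have h := (Finset.mem_powersetCard.1 A.2).2
            omega⟩, fun h => by
            simpa using (Finset.mem_powersetCard.1 A.2).1 h⟩
        left_inv := fun _ => rfl
        right_inv := fun _ => rfl }
    rw [Nat.card_congr e, Nat.card_eq_fintype_card, Fintype.card_coe, Finset.card_powersetCard,
      hcard, Nat.choose_symm (by omega)]
  · rw [Nat.choose_eq_zero_of_lt (by omega), Nat.card_eq_zero]
    exact Or.inl ⟨fun ⟨A, _⟩ => by
      have := A.2.2
      omega⟩

end Quotient

end CyclicColoring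

end

theorem lemma5p2 (K : Type*) [Field K] [CharZero K] (n : ℕ) (hn : 3 ≤ n) :
    -- degree `-1`
    Module.rank K (HC01 K hn 0) = 0 ∧
    -- degree `r ≥ 0`
    (∀ r : ℕ, Module.rank K (HC01 K hn (r + 1)) = ((n - 2).choose r : ℕ)) ∧
    -- representatives in degree `k - 1`
    ∀ k : ℕ,
      ∃ hz : ∀ A : RepIndex (v₁ hn) k,
          qRepChain K (v₂ hn) (v₃ hn) A ∈ cycles (boundary01 K hn) k,
        Submodule.span K (Set.range
          fun A : {A : RepIndex (v₁ hn) k // ¬(v₂ hn ∈ A.1 ∧ v₃ hn ∈ A.1)} =>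
            homologyClass (boundary01 K hn) k ⟨qRepChain K (v₂ hn) (v₃ hn) A.1, hz A.1⟩) = ⊤ ∧
        LinearIndependent K
          (fun A : {A : RepIndex (v₁ hn) k // v₃ hn ∉ A.1} =>
            homologyClass (boundary01 K hn) k ⟨qRepChain K (v₂ hn) (v₃ hn) A.1, hz A.1⟩) ∧
        Submodule.span K (Set.range
          fun A : {A : RepIndex (v₁ hn) k // v₃ hn ∉ A.1} =>
            homologyClass (boundary01 K hn) k ⟨qRepChain K (v₂ hn) (v₃ hn) A.1, hz A.1⟩) = ⊤ := by
  have h23 : v₂ hn ≠ v₃ hn := by simp [v₂, v₃]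
  have h31 : v₃ hn ≠ v₁ hn := by simp [v₁, v₃]
  refine ⟨?_, fun r => ?_, fun k => ⟨fun A => qRepChain_mem_cycles A, ?_,
    linearIndependent_repClass h23 h31, span_repClass h23 h31⟩⟩
  · exact (rank_homology h23 h31).trans (by rw [card_repIndex_zero h31, Nat.cast_zero])
  · exact (rank_homology h23 h31).trans (by rw [card_repIndex_succ h31])
  -- The family omitting only the sets that contain both 2 and 3 includes the basis.
  · rw [eq_top_iff, ← span_repClass (K := K) (k := k) h23 h31]
    refine Submodule.span_mono ?_
    rintro _ ⟨A, rfl⟩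
    exact ⟨⟨A.1, fun h => A.2 h.2⟩, rfl⟩
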